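/- For each integer $d\ge 1$ let $S_d:F_d\to G_d$ be a nonzero compact linear operator between real separable Hilbert spaces, and let $\$:[0,\infty)\times\{1,2,\dots\}\to[1,\infty]$ be a cost function, where $\$(\sigma,d)$ is non-increasing in $\sigma$ and non-decreasing in $d$. Adaptive information $N$ about $f\in F_d$ consists of successive observations $y_i=L_i(f;y_1,\dots,y_{i-1})+e_i$, where $L_i(\cdot\,;y_1,\dots,y_{i-1})$ is a continuous linear functional on $F_d$ of norm at most $1$, and $e_i=\sigma_i(y_1,\dots,y_{i-1})\,\omega_i$ with precisions $\sigma_i(\cdot)\in[0,\infty)$ and independent standard Gaussian variables $\omega_1,\omega_2,\dots$ (Gaussian noise). The process terminates as soon as $(y_1,\dots,y_n)\in Y$, where $Y$ is a given set of finite sequences such that every infinite real sequence has exactly one initial segment (possibly the empty one) in $Y$; then $n=n(\mathbf y)$. All functions and sets involved in $N$ are measurable. An algorithm is a measurable map $\Phi:Y\to G_d$. Let $\pi_f$ be the distribution of $\mathbf y$ for given $f$, and put $$\mathrm{cost}(N)=\sup_{\|f\|\le 1}\int_Y\sum_{i=1}^{n(\mathbf y)}\$\big(\sigma_i(y_1,\dots,y_{i-1}),d\big)\,\pi_f(\mathrm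 d\mathbf y),\qquad \mathrm e(S_d,N,\Phi)=\sup_{\|f\|\le 1}\Big(\int_Y\|S_d(f)-\Phi(\mathbf y)\|^2\,\pi_f(\mathrm d\mathbf y)\Big)^{1/2}.$$ Let * $\mathrm{comp}^{\mathrm{wa}}_\$(\varepsilon,d)=\inf\{\mathrm{cost}(N):\ N,\Phi \text{ such that } \mathrm e(S_d,N,\Phi)\le\varepsilon\|S_d\|\}$; * $\mathrm n^{\mathrm w}(\varepsilon,d)$ be the complexity for exact information, i.e., the minimal number (in the worst case over $\|f\|\le 1$) of exact, adaptively chosen evaluations of functionals of norm at most $1$ from which $S_d(f)$ can be approximated with error at most $\varepsilon\|S_d\|$ for all $\|f\|\le1$; * $\widehat\$(\sigma,d)$ be the complexity of approximating a real parameter: the infimum of $\sup_{f\in\mathbb R}\int_Y\sum_{i=1}^{n(\mathbf y)}\$(\sigma_i,d)\,\pi_f(\mathrm d\mathbf y)$ over all adaptive information consisting of observations $y_i=f+e_i$ of $f\in\mathbb R$ itself, with Gaussian noise and adaptively chosen precisions $\sigma_i=\sigma_i(y_1,\dots,y_{i-1})$ and termination as above, and all measurable $\Phi:Y\to\mathbb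 R$, such that $\sup_{f\in\mathbb R}\big(\int_Y|f-\Phi(\mathbf y)|^2\,\pi_f(\mathrm d\mathbf y)\big)^{1/2}\le\sigma$. Then for all $\varepsilon\in(0,1)$ and $d\ge 1$, $$\mathrm{comp}^{\mathrm{wa}}_\$(\varepsilon,d)\ \ge\ \frac{\mathrm n^{\mathrm w}(2\varepsilon,d)+1}{4}.$$ Moreover, there is an absolute constant $c\in(0,1)$ such that for all $\varepsilon\in(0,c)$ and $d\ge1$, $$\mathrm{comp}^{\mathrm{wa}}_\$(\varepsilon,d)\ \ge\ \frac12\,\widehat\$\Big(\frac{\varepsilon}{c\sqrt2},d\Big).$$ -/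

import Mathlib

open MeasureTheory ProbabilityTheory
open scoped NNReal ENNReal

namespace NoisyInfo

/-- A cost function `$ : [0, ∞) × {1, 2, …} → [1, ∞]`: `cost σ d` is the price of one noisy
evaluation with precision `σ` in dimension `d`. It is non-decreasing in `σ⁻¹` and in `d`. -/
structure IsCostFunction (cost : ℝ≥0 → ℕ+ → ℝ≥0∞) : Prop where
  one_le : ∀ σ d, 1 ≤ cost σ d
  antitone_precision : ∀ d, Antitone fun σ => cost σ d
  monotone_dim : ∀ σ, Monotone fun d => cost σ d

/-- Adaptive information about elements of `F`. After the values `y₀, …, y_{i-1}` have been seen,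
the next functional is `L i y` (of norm at most one) and it is evaluated with precision `σ i y`.
The process stops as soon as the finite sequence of values is in the set `⋃ n, Y n` of all values
of information; every infinite real sequence has exactly one initial segment in this set. -/
structure AdaptiveInfo (F : Type*) [NormedAddCommGroup F] [NormedSpace ℝ F] where
  L : (i : ℕ) → (Fin i → ℝ) → (F →L[ℝ] ℝ)
  norm_L_le : ∀ i y, ‖L i y‖ ≤ 1
  σ : (i : ℕ) → (Fin i → ℝ) → ℝ≥0
  Y : (n : ℕ) → Set (Fin n → ℝ)
  existsUnique_mem : ∀ y : ℕ → ℝ, ∃! n : ℕ, (fun i : Fin n => y i) ∈ Y n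

namespace AdaptiveInfo

variable {F : Type*} [NormedAddCommGroup F] [NormedSpace ℝ F]

/-- The measurability needed for Gaussian noise. -/
structure IsMeasurable (N : AdaptiveInfo F) : Prop where
  measurable_L : ∀ i f, Measurable fun y => N.L i y f
  measurable_σ : ∀ i, Measurable (N.σ i)
  measurableSet_Y : ∀ n, MeasurableSet (N.Y n)

/-- The first `n` observations of `f` (termination disregarded) when the normalized noise is `ω`:
`yᵢ = Lᵢ(f; y₀, …, y_{i-1}) + σᵢ(y₀, …, y_{i-1}) ωᵢ`. -/
noncomputable def obs (N : AdaptiveInfo F) (f : F) (ω : ℕ → ℝ) : (n : ℕ) → Fin n → ℝ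
  | 0 => Fin.elim0
  | n + 1 => Fin.snoc (α := fun _ => ℝ) (obs N f ω n)
      (N.L n (obs N f ω n) f + (N.σ n (obs N f ω n) : ℝ) * ω n)

theorem obs_eq (N : AdaptiveInfo F) (f : F) (ω : ℕ → ℝ) (n : ℕ) :
    N.obs f ω n = fun i : Fin n => N.obs f ω (i + 1) (Fin.last i) := by
  induction n with
  | zero => funext i; exact i.elim0
  | succ n ih =>
    funext i
    refine Fin.lastCases ?_ (fun j => ?_) i
    · rfl
    · have h : N.obs f ω (n + 1) j.castSucc = N.obs f ω n j := by
        simp [obs]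
      rw [h]
      exact congrFun ih j

theorem existsUnique_obs_mem (N : AdaptiveInfo F) (f : F) (ω : ℕ → ℝ) :
    ∃! n : ℕ, N.obs f ω n ∈ N.Y n := by
  have h := N.existsUnique_mem fun i => N.obs f ω (i + 1) (Fin.last i)
  simpa only [← N.obs_eq f ω] using h

/-- The number `n(y)` of observations made before termination. -/
noncomputable def numObs (N : AdaptiveInfo F) (f : F) (ω : ℕ → ℝ) : ℕ :=
  (N.existsUnique_obs_mem f ω).choose

/-- The information is exact: all evaluations are made without noise. -/
def IsExact (N : AdaptiveInfo F) : Prop := ∀ i y, N.σ i y = 0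

end AdaptiveInfo

/-- An algorithm maps finite sequences of observations to elements of `G`
(only its values on the set of all values of information matter). -/
abbrev Algorithm (G : Type*) := (n : ℕ) → (Fin n → ℝ) → G

/-- The law of a sequence of independent standard Gaussian variables. -/
noncomputable def stdNoise : Measure (ℕ → ℝ) := Measure.infinitePi fun _ => gaussianReal 0 1

section Settings

variable {F G : Type*} [NormedAddCommGroup F] [NormedSpace ℝ F]
  [NormedAddCommGroup G] [NormedSpace ℝ G]

/-- The output of the algorithm `Φ` using information `N` for the instance `f` and noise `ω`. -/
noncomputable def output (N : AdaptiveInfo F) (Φ : Algorithm G) (f : F) (ω : ℕ → ℝ) : G :=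
  Φ (N.numObs f ω) (N.obs f ω (N.numObs f ω))

/-- Gaussian noise: the worst (over `f ∈ K`) expected total cost of the information `N`. -/
noncomputable def costWA (cost : ℝ≥0 → ℝ≥0∞) (K : Set F) (N : AdaptiveInfo F) : ℝ≥0∞ :=
  ⨆ f ∈ K, ∫⁻ ω, ∑ i ∈ Finset.range (N.numObs f ω), cost (N.σ i (N.obs f ω i)) ∂stdNoise

/-- Gaussian noise: the worst (over `f ∈ K`) root mean square error of `Φ` using `N`. -/
noncomputable def errWA (S : F →L[ℝ] G) (K : Set F) (N : AdaptiveInfo F) (Φ : Algorithm G) :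
    ℝ≥0∞ :=
  ⨆ f ∈ K, (∫⁻ ω, ‖S f - output N Φ f ω‖ₑ ^ 2 ∂stdNoise) ^ (1 / 2 : ℝ)

/-- The information `ε`-complexity of `S` for Gaussian noise, over the unit ball of `F`, with
the normalized error. -/
noncomputable def compWA (cost : ℝ≥0 → ℝ≥0∞) (S : F →L[ℝ] G) (ε : ℝ≥0) : ℝ≥0∞ :=
  sInf {a | ∃ (N : AdaptiveInfo F) (Φ : Algorithm G),
    N.IsMeasurable ∧ (∀ n, StronglyMeasurable (Φ n)) ∧
    errWA S (Metric.closedBall 0 1) N Φ ≤ ε * ‖S‖ₑ ∧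
    a = costWA cost (Metric.closedBall 0 1) N}

/-- The worst case `ε`-complexity of `S` for exact information: the minimal (worst case) number of
exact evaluations of functionals of norm at most one, chosen adaptively, which allow to approximate
`S` on the unit ball of `F` with error at most `ε ‖S‖`. With exact information the noise variable
is irrelevant, and it is put equal to zero. -/
noncomputable def nWorst (S : F →L[ℝ] G) (ε : ℝ≥0) : ℝ≥0∞ :=
  sInf {a | ∃ (N : AdaptiveInfo F) (Φ : Algorithm G), N.IsExact ∧
    (⨆ f ∈ Metric.closedBall (0 : F) 1, ‖S f - output N Φ f 0‖ₑ) ≤ ε * ‖S‖ₑ ∧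
    a = ⨆ f ∈ Metric.closedBall (0 : F) 1, (N.numObs f 0 : ℝ≥0∞)}

end Settings

/-- The auxiliary cost function: the complexity, for Gaussian noise, of approximating a real
parameter `f`, ranging over the whole line, with root mean square error at most `σ`, from noisy
observations of `f` itself with adaptively chosen precisions. -/
noncomputable def auxCost (cost : ℝ≥0 → ℕ+ → ℝ≥0∞) (σ : ℝ≥0) (d : ℕ+) : ℝ≥0∞ :=
  sInf {a | ∃ (N : AdaptiveInfo ℝ) (Φ : Algorithm ℝ),
    (∀ i y, N.L i y = ContinuousLinearMap.id ℝ ℝ) ∧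
    N.IsMeasurable ∧ (∀ n, StronglyMeasurable (Φ n)) ∧
    errWA (ContinuousLinearMap.id ℝ ℝ) Set.univ N Φ ≤ σ ∧
    a = costWA (fun s => cost s d) Set.univ N}

end NoisyInfo

/-!
Exact information: for a fixed noise sequence the strategy is an exact adaptive one, and each
observation lowers the dimension of the slice of the unit ball known to contain `f` by at most one.
Averaging over slices with the weight `1 - ‖f‖²` trades the mean squared error for the number of
observations, so the cost is bounded below in terms of the dimension of a subspace on which
`2 ε ‖S‖ ‖x‖ ≤ ‖S x‖`. By the inertia of the quadratic form `‖S x‖² - (2 ε ‖S‖)² ‖x‖²`, the largest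
such dimension is an upper bound for the number of exact observations needed.

Gaussian noise: by the Cauchy–Schwarz inequality the laws of the observations of `v`, `-v` and `0`
are so close that `v` and `-v` cannot be told apart, where `‖v‖ ≤ 16 ε` and `8 ε ‖S‖ ≤ ‖S v‖`,
unless some sequence of observations of at most twice the total cost has Fisher information greater
than `(16 ε)⁻²`. Inverse-variance weighting of observations with the same precisions then
estimates a real parameter.
-/

namespace NoisyInfo

namespace AdaptiveInfo

variable {F : Type*} [NormedAddCommGroup F] [NormedSpace ℝ F] (N : AdaptiveInfo F)

theorem obs_numObs_mem (f : F) (ω : ℕ → ℝ) : N.obs f ω (N.numObs f ω) ∈ N.Y (N.numObs f ω) :=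
  (N.existsUnique_obs_mem f ω).choose_spec.1

theorem numObs_eq_iff {f : F} {ω : ℕ → ℝ} {n : ℕ} : N.numObs f ω = n ↔ N.obs f ω n ∈ N.Y n :=
  ⟨fun h => h ▸ N.obs_numObs_mem f ω,
    fun h => ((N.existsUnique_obs_mem f ω).choose_spec.2 n h).symm⟩

theorem take_obs (f : F) (ω : ℕ → ℝ) {m n : ℕ} (h : m ≤ n) :
    Fin.take m h (N.obs f ω n) = N.obs f ω m := by
  rw [N.obs_eq f ω n, N.obs_eq f ω m]
  rfl

theorem obs_eq_of_le {f g : F} {ω ω' : ℕ → ℝ} {m n : ℕ} (h : m ≤ n)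
    (hn : N.obs f ω n = N.obs g ω' n) : N.obs f ω m = N.obs g ω' m := by
  rw [← N.take_obs f ω h, ← N.take_obs g ω' h, hn]

theorem lt_numObs_of_obs_eq {f g : F} {ω ω' : ℕ → ℝ} {n : ℕ} (h : N.obs f ω n = N.obs g ω' n)
    (hn : n < N.numObs f ω) : n < N.numObs g ω' := by
  by_contra! hle
  have hmem := N.obs_numObs_mem g ω'
  rw [← N.obs_eq_of_le hle h, ← N.numObs_eq_iff] at hmem
  omega

theorem obs_succ_congr {f g : F} {ω : ℕ → ℝ} {n : ℕ} (h : N.obs f ω n = N.obs g ω n)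
    (hL : N.L n (N.obs g ω n) f = N.L n (N.obs g ω n) g) :
    N.obs f ω (n + 1) = N.obs g ω (n + 1) := by
  rw [obs, obs, h, hL]

/-- A family of instances all of whose evaluations by `N` are jointly measurable in the parameter
and the previous observations. This replaces measurability of `f`, since no σ-algebra is given on
`F`. -/
def MeasurableEval {X : Type*} [MeasurableSpace X] (f : X → F) : Prop :=
  ∀ i, Measurable fun q : X × (Fin i → ℝ) => N.L i q.2 (f q.1)

variable {N} {X : Type*} [MeasurableSpace X]

theorem MeasurableEval.add {f g : X → F} (hf : N.MeasurableEval f) (hg : N.MeasurableEval g) :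
    N.MeasurableEval fun p => f p + g p := fun i => by
  simp only [map_add]
  exact (hf i).add (hg i)

namespace IsMeasurable

variable (hN : N.IsMeasurable)

include hN

theorem measurableEval_const (f : F) : N.MeasurableEval fun _ : X => f := fun i =>
  (hN.measurable_L i f).comp measurable_snd

theorem measurableEval_linearMap {d : ℕ} (A : EuclideanSpace ℝ (Fin d) →ₗ[ℝ] F)
    {x : X → EuclideanSpace ℝ (Fin d)} (hx : Measurable x) :
    N.MeasurableEval fun p => A (x p) := by
  intro i
  set b := EuclideanSpace.basisFun (Fin d) ℝ
  have hsum : ∀ q : X × (Fin i → ℝ),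
      N.L i q.2 (A (x q.1)) = ∑ j, x q.1 j * N.L i q.2 (A (b j)) := fun q => by
    conv_lhs => rw [← b.sum_repr (x q.1)]
    simp [b, map_sum]
  simp only [hsum]
  refine Finset.measurable_sum _ fun j _ => Measurable.mul ?_ (hN.measurableEval_const _ i)
  exact (by fun_prop : Measurable fun z : EuclideanSpace ℝ (Fin d) => z j).comp
    (hx.comp measurable_fst)

variable {f : X → F} (hf : N.MeasurableEval f) {w : X → ℕ → ℝ} (hw : Measurable w)

include hf hw

theorem measurable_obs (n : ℕ) : Measurable fun p => N.obs (f p) (w p) n := by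
  induction n with
  | zero => exact measurable_pi_iff.2 fun i => i.elim0
  | succ n ih =>
    refine measurable_pi_iff.2 fun i => Fin.lastCases ?_ (fun j => ?_) i
    · simp only [obs, Fin.snoc_last]
      exact ((hf n).comp (measurable_id.prodMk ih)).add
        (((hN.measurable_σ n).comp ih).coe_nnreal_real.mul ((measurable_pi_apply n).comp hw))
    · simp only [obs, Fin.snoc_castSucc]
      exact (measurable_pi_apply j).comp ih

theorem measurable_numObs : Measurable fun p => N.numObs (f p) (w p) := by
  refine measurable_to_countable' fun n => ?_
  have hpre : (fun p => N.numObs (f p) (w p)) ⁻¹' {n} = (fun p => N.obs (f p) (w p) n) ⁻¹' N.Y n :=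
    Set.ext fun p => N.numObs_eq_iff
  rw [hpre]
  exact hN.measurable_obs hf hw n (hN.measurableSet_Y n)

theorem measurable_comp_numObs {β : Type*} [MeasurableSpace β] {u : ℕ → X → β}
    (hu : ∀ n, Measurable (u n)) : Measurable fun p => u (N.numObs (f p) (w p)) p := by
  have h : Measurable fun q : X × ℕ => u q.2 q.1 := measurable_from_prod_countable_left hu
  exact h.comp (measurable_id.prodMk (hN.measurable_numObs hf hw))

theorem measurable_enorm_sub_output {G : Type*} [NormedAddCommGroup G] {Φ : Algorithm G}
    (hΦ : ∀ n, StronglyMeasurable (Φ n)) {g : X → G} (hg : StronglyMeasurable g) :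
    Measurable fun p => ‖g p - output N Φ (f p) (w p)‖ₑ :=
  hN.measurable_comp_numObs hf hw (u := fun n p => ‖g p - Φ n (N.obs (f p) (w p) n)‖ₑ) fun n =>
    (hg.sub ((hΦ n).comp_measurable (hN.measurable_obs hf hw n))).enorm

end IsMeasurable

/-- Nonadaptive information: `n` observations of given functionals with given precisions. The
functionals `ℓ i` with `n ≤ i` are never observed, but make up the field `L`. -/
noncomputable def nonadaptive {n : ℕ} (ℓ : ℕ → F →L[ℝ] ℝ) (hℓ : ∀ i, ‖ℓ i‖ ≤ 1)
    (τ : Fin n → ℝ≥0) : AdaptiveInfo F where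
  L i _ := ℓ i
  norm_L_le i _ := hℓ i
  σ i _ := if h : i < n then τ ⟨i, h⟩ else 0
  Y m := {_y | m = n}
  existsUnique_mem _ := ⟨n, rfl, fun _ h => h⟩

section nonadaptive

variable {n : ℕ} (ℓ : ℕ → F →L[ℝ] ℝ) (hℓ : ∀ i, ‖ℓ i‖ ≤ 1) (τ : Fin n → ℝ≥0)

theorem nonadaptive_isMeasurable : (nonadaptive ℓ hℓ τ).IsMeasurable where
  measurable_L _ _ := by simp only [nonadaptive, measurable_const]
  measurable_σ _ := measurable_const
  measurableSet_Y _ := MeasurableSet.const _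

theorem numObs_nonadaptive (f : F) (ω : ℕ → ℝ) : (nonadaptive ℓ hℓ τ).numObs f ω = n :=
  (numObs_eq_iff _).2 rfl

theorem obs_nonadaptive (f : F) (ω : ℕ → ℝ) :
    (nonadaptive ℓ hℓ τ).obs f ω n = fun i : Fin n => ℓ i f + τ i * ω i := by
  rw [obs_eq]
  funext i
  simp [obs, nonadaptive]

theorem output_nonadaptive {G : Type*} (Φ : Algorithm G) (f : F) (ω : ℕ → ℝ) :
    output (nonadaptive ℓ hℓ τ) Φ f ω = Φ n fun i : Fin n => ℓ i f + τ i * ω i := by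
  rw [output, numObs_nonadaptive, obs_nonadaptive]

end nonadaptive

end AdaptiveInfo

instance : IsProbabilityMeasure stdNoise := by
  unfold stdNoise
  infer_instance

theorem enorm_le_coe_mul_enorm_iff {E E' : Type*} [SeminormedAddGroup E] [SeminormedAddGroup E']
    {a : E} {b : E'} {ε : ℝ≥0} : ‖a‖ₑ ≤ ε * ‖b‖ₑ ↔ ‖a‖ ≤ ε * ‖b‖ := by
  rw [enorm_eq_nnnorm, enorm_eq_nnnorm]
  exact_mod_cast Iff.rfl

section CostError

variable {F G : Type*} [NormedAddCommGroup F] [NormedSpace ℝ F]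
  [NormedAddCommGroup G] [NormedSpace ℝ G]

theorem lintegral_sq_le_of_errWA_le {S : F →L[ℝ] G} {K : Set F} {N : AdaptiveInfo F}
    {Φ : Algorithm G} {r : ℝ≥0∞} (h : errWA S K N Φ ≤ r) {f : F} (hf : f ∈ K) :
    ∫⁻ ω, ‖S f - output N Φ f ω‖ₑ ^ 2 ∂stdNoise ≤ r ^ 2 := by
  have hroot : (∫⁻ ω, ‖S f - output N Φ f ω‖ₑ ^ 2 ∂stdNoise) ^ (1 / 2 : ℝ) ≤ r :=
    (le_iSup₂ (f := fun f (_ : f ∈ K) =>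
      (∫⁻ ω, ‖S f - output N Φ f ω‖ₑ ^ 2 ∂stdNoise) ^ (1 / 2 : ℝ)) f hf).trans h
  have hsq := ENNReal.rpow_le_rpow hroot (z := 2) (by norm_num)
  rw [← ENNReal.rpow_mul] at hsq
  simpa using hsq

theorem lintegral_le_costWA (cost : ℝ≥0 → ℝ≥0∞) {K : Set F} (N : AdaptiveInfo F) {f : F}
    (hf : f ∈ K) :
    ∫⁻ ω, ∑ i ∈ Finset.range (N.numObs f ω), cost (N.σ i (N.obs f ω i)) ∂stdNoise
      ≤ costWA cost K N :=
  le_iSup₂ (f := fun f (_ : f ∈ K) =>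
    ∫⁻ ω, ∑ i ∈ Finset.range (N.numObs f ω), cost (N.σ i (N.obs f ω i)) ∂stdNoise) f hf

theorem lintegral_numObs_le_costWA {cost : ℝ≥0 → ℝ≥0∞} (hc : ∀ σ, 1 ≤ cost σ) {K : Set F}
    (N : AdaptiveInfo F) {f : F} (hf : f ∈ K) :
    ∫⁻ ω, (N.numObs f ω : ℝ≥0∞) ∂stdNoise ≤ costWA cost K N := by
  refine (lintegral_mono fun ω => ?_).trans (lintegral_le_costWA cost N hf)
  calc (N.numObs f ω : ℝ≥0∞) = ∑ _i ∈ Finset.range (N.numObs f ω), (1 : ℝ≥0∞) := by simp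
    _ ≤ _ := Finset.sum_le_sum fun i _ => hc _

end CostError

section Ball

theorem lintegral_sub_norm_sq_eq_setLIntegral {E : Type*} [NormedAddCommGroup E] [MeasurableSpace E]
    (μ : Measure E) (r : ℝ) :
    ∫⁻ x, ENNReal.ofReal (r - ‖x‖ ^ 2) ∂μ
      = ∫⁻ x in {x : E | ‖x‖ ^ 2 ≤ r}, ENNReal.ofReal (r - ‖x‖ ^ 2) ∂μ := by
  refine (setLIntegral_eq_of_support_subset fun x hx => ?_).symm
  by_contra h
  exact hx (ENNReal.ofReal_eq_zero.2 (by simpa using (not_le.1 h).le))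

variable {E : Type*} [NormedAddCommGroup E] [NormedSpace ℝ E] [FiniteDimensional ℝ E]
  [MeasurableSpace E] [BorelSpace E] (μ : Measure E) [μ.IsAddHaarMeasure]

theorem setLIntegral_closedBall_fun_norm [Nontrivial E] {a : ℝ} (ha : 0 ≤ a) {g : ℝ → ℝ}
    (hg : Continuous g) (hg0 : ∀ y ∈ Set.Icc 0 a, 0 ≤ g y) :
    ∫⁻ x in Metric.closedBall 0 a, ENNReal.ofReal (g ‖x‖) ∂μ
      = μ (Metric.ball 0 1) * ENNReal.ofReal
        (Module.finrank ℝ E * ∫ y in 0..a, y ^ (Module.finrank ℝ E - 1) * g y) := by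
  have hball : Metric.closedBall (0 : E) a = norm ⁻¹' Set.Iic a := by ext x; simp
  have hint : IntegrableOn (fun x : E => g ‖x‖) (Metric.closedBall 0 a) μ :=
    (hg.comp continuous_norm).continuousOn.integrableOn_compact (isCompact_closedBall _ _)
  have hnonneg : ∀ᵐ x ∂μ.restrict (Metric.closedBall 0 a), 0 ≤ g ‖x‖ :=
    (ae_restrict_iff' measurableSet_closedBall).2
      (ae_of_all _ fun x hx => hg0 _ ⟨norm_nonneg x, mem_closedBall_zero_iff.1 hx⟩)
  have hradial : ∫ x in Metric.closedBall 0 a, g ‖x‖ ∂μ = Module.finrank ℝ E •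
      μ.real (Metric.ball 0 1) • ∫ y in Set.Ioi (0 : ℝ), y ^ (Module.finrank ℝ E - 1) •
        (Set.Iic a).indicator g y := by
    rw [← integral_fun_norm_addHaar, ← integral_indicator measurableSet_closedBall, hball]
    exact integral_congr_ae (ae_of_all _ fun x => Set.indicator_comp_right norm)
  have hinterval : ∫ y in Set.Ioi (0 : ℝ), y ^ (Module.finrank ℝ E - 1) •
      (Set.Iic a).indicator g y = ∫ y in 0..a, y ^ (Module.finrank ℝ E - 1) * g y := by
    rw [intervalIntegral.integral_of_le ha, ← Set.Ioi_inter_Iic,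
      ← setIntegral_indicator measurableSet_Iic]
    simp only [smul_eq_mul, Set.indicator_mul_right]
  rw [← ofReal_integral_eq_lintegral_ofReal hint hnonneg, hradial, hinterval,
    ← ofReal_measureReal (by finiteness), ← ENNReal.ofReal_mul measureReal_nonneg]
  simp only [nsmul_eq_mul, smul_eq_mul]
  ring_nf

/-- The case `r = a ^ 2`: in polar coordinates, `2 ∫₀ᵃ yⁿ⁺¹ = n ∫₀ᵃ yⁿ⁻¹ (a² - y²)`. -/
theorem two_mul_lintegral_norm_sq_closedBall {a : ℝ} (ha : 0 ≤ a) :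
    2 * ∫⁻ x in Metric.closedBall (0 : E) a, ENNReal.ofReal (‖x‖ ^ 2) ∂μ
      = Module.finrank ℝ E * ∫⁻ x in Metric.closedBall (0 : E) a,
          ENNReal.ofReal (a ^ 2 - ‖x‖ ^ 2) ∂μ := by
  rcases subsingleton_or_nontrivial E with hE | hE
  · simp [Module.finrank_zero_of_subsingleton, Subsingleton.eq_zero]
  rw [setLIntegral_closedBall_fun_norm μ ha (g := fun y => y ^ 2) (by fun_prop)
      fun y _ => sq_nonneg y,
    setLIntegral_closedBall_fun_norm μ ha (g := fun y => a ^ 2 - y ^ 2) (by fun_prop)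
      fun y hy => sub_nonneg.2 (pow_le_pow_left₀ hy.1 hy.2 2)]
  have hn : Module.finrank ℝ E - 1 + 1 = Module.finrank ℝ E :=
    Nat.sub_add_cancel Module.finrank_pos
  generalize Module.finrank ℝ E - 1 = n at hn
  rw [← hn, ← ENNReal.ofReal_natCast (n + 1), ← ENNReal.ofReal_ofNat 2, mul_left_comm,
    mul_left_comm (ENNReal.ofReal _), ← ENNReal.ofReal_mul (by positivity),
    ← ENNReal.ofReal_mul (by positivity)]
  congr 2
  have hsq : ∫ y in 0..a, y ^ n * y ^ 2 = a ^ (n + 3) / (n + 3) := by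
    simp_rw [← pow_add, integral_pow]
    push_cast
    ring
  have hweight : ∫ y in 0..a, y ^ n * (a ^ 2 - y ^ 2)
      = a ^ (n + 3) / (n + 1) - a ^ (n + 3) / (n + 3) := by
    simp_rw [mul_sub]
    rw [intervalIntegral.integral_sub ((by fun_prop : Continuous _).intervalIntegrable _ _)
      ((by fun_prop : Continuous _).intervalIntegrable _ _), hsq,
      intervalIntegral.integral_mul_const, integral_pow]
    ring
  rw [hsq, hweight]
  push_cast
  field_simp
  ring

theorem two_mul_lintegral_norm_sq_le (r : ℝ) :
    2 * ∫⁻ x in {x : E | ‖x‖ ^ 2 ≤ r}, ENNReal.ofReal (‖x‖ ^ 2) ∂μ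
      = Module.finrank ℝ E * ∫⁻ x, ENNReal.ofReal (r - ‖x‖ ^ 2) ∂μ := by
  rw [lintegral_sub_norm_sq_eq_setLIntegral]
  rcases lt_or_ge r 0 with hr | hr
  · have hempty : {x : E | ‖x‖ ^ 2 ≤ r} = ∅ :=
      Set.eq_empty_of_forall_notMem fun x hx => (hr.trans_le (sq_nonneg ‖x‖)).not_ge hx
    simp [hempty]
  · have hball : {x : E | ‖x‖ ^ 2 ≤ r} = Metric.closedBall 0 √r := by
      ext x
      rw [mem_closedBall_zero_iff, Real.le_sqrt (norm_nonneg x) hr, Set.mem_ofPred_eq]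
    have h := two_mul_lintegral_norm_sq_closedBall μ (Real.sqrt_nonneg r)
    rwa [Real.sq_sqrt hr, ← hball] at h

theorem two_mul_measure_closedBall :
    2 * μ (Metric.closedBall 0 1)
      = (Module.finrank ℝ E + 2) * ∫⁻ x, ENNReal.ofReal (1 - ‖x‖ ^ 2) ∂μ := by
  have hball : {x : E | ‖x‖ ^ 2 ≤ 1} = Metric.closedBall 0 1 := by ext x; simp
  have hsplit : μ (Metric.closedBall 0 1)
      = (∫⁻ x in {x : E | ‖x‖ ^ 2 ≤ 1}, ENNReal.ofReal (‖x‖ ^ 2) ∂μ)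
        + ∫⁻ x, ENNReal.ofReal (1 - ‖x‖ ^ 2) ∂μ := by
    rw [lintegral_sub_norm_sq_eq_setLIntegral, ← lintegral_add_left (by fun_prop), hball,
      ← setLIntegral_one]
    refine setLIntegral_congr_fun measurableSet_closedBall fun x hx => ?_
    have hx1 : 0 ≤ 1 - ‖x‖ ^ 2 := by simpa using hx
    rw [← ENNReal.ofReal_add (sq_nonneg _) hx1, add_sub_cancel, ENNReal.ofReal_one]
  rw [hsplit, mul_add, two_mul_lintegral_norm_sq_le, add_mul]

theorem lintegral_one_sub_norm_sq_ne_top : ∫⁻ x, ENNReal.ofReal (1 - ‖x‖ ^ 2) ∂μ ≠ ∞ := by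
  intro h
  have hball := two_mul_measure_closedBall μ
  rw [h, ENNReal.mul_top (by simp)] at hball
  exact ENNReal.mul_ne_top (by simp) measure_closedBall_lt_top.ne hball

theorem lintegral_one_sub_norm_sq_ne_zero : ∫⁻ x, ENNReal.ofReal (1 - ‖x‖ ^ 2) ∂μ ≠ 0 := by
  intro h
  have hball := two_mul_measure_closedBall μ
  rw [h, mul_zero, mul_eq_zero] at hball
  exact hball.elim two_ne_zero (Metric.measure_closedBall_pos μ 0 one_pos).ne'

end Ball

section ConsCoord

variable {d : ℕ}

/-- The point with first coordinate `p.1` and remaining coordinates `p.2`. -/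
noncomputable def consCoord (p : ℝ × EuclideanSpace ℝ (Fin d)) : EuclideanSpace ℝ (Fin (d + 1)) :=
  WithLp.toLp 2 (Fin.cons (α := fun _ => ℝ) p.1 p.2)

theorem norm_sq_consCoord (p : ℝ × EuclideanSpace ℝ (Fin d)) :
    ‖consCoord p‖ ^ 2 = p.1 ^ 2 + ‖p.2‖ ^ 2 := by
  rw [EuclideanSpace.real_norm_sq_eq, EuclideanSpace.real_norm_sq_eq, Fin.sum_univ_succ]
  simp [consCoord]

theorem consCoord_eq_add (t : ℝ) (z : EuclideanSpace ℝ (Fin d)) :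
    consCoord (t, z) = consCoord (t, 0) + consCoord (0, z) := by
  ext j
  refine Fin.cases ?_ (fun j => ?_) j <;> simp [consCoord]

theorem inner_consCoord (t : ℝ) (z : EuclideanSpace ℝ (Fin d)) :
    inner ℝ (consCoord (t, 0)) (consCoord (0, z)) = 0 := by
  rw [PiLp.inner_apply, Fin.sum_univ_succ]
  simp [consCoord]

theorem measurePreserving_consCoord :
    MeasurePreserving (consCoord (d := d)) (volume.prod volume) volume := by
  have hofLp : MeasurePreserving (Prod.map id (WithLp.ofLp (p := 2)) :
      ℝ × EuclideanSpace ℝ (Fin d) → ℝ × (Fin d → ℝ)) (volume.prod volume) (volume.prod volume) :=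
    (MeasurePreserving.id volume).prod (PiLp.volume_preserving_ofLp (Fin d))
  have hcons := (volume_preserving_piFinSuccAbove (fun _ : Fin (d + 1) => ℝ) 0).symm
  have hcomp : consCoord (d := d) = WithLp.toLp 2 ∘
      (MeasurableEquiv.piFinSuccAbove (fun _ => ℝ) 0).symm ∘
        Prod.map id (WithLp.ofLp (p := 2)) := by
    funext p
    simp [consCoord, Fin.consEquiv]
  rw [hcomp]
  exact (PiLp.volume_preserving_toLp (Fin (d + 1))).comp (hcons.comp hofLp)

/-- `consCoord` at first coordinate zero, as a linear isometry. -/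
noncomputable def consZero (d : ℕ) :
    EuclideanSpace ℝ (Fin d) →ₗᵢ[ℝ] EuclideanSpace ℝ (Fin (d + 1)) where
  toFun z := consCoord (0, z)
  map_add' x y := by
    ext j
    refine Fin.cases ?_ (fun j => ?_) j <;> simp [consCoord]
  map_smul' c x := by
    ext j
    refine Fin.cases ?_ (fun j => ?_) j <;> simp [consCoord]
  norm_map' x := (sq_eq_sq₀ (norm_nonneg _) (norm_nonneg _)).1 <| by
    simpa using norm_sq_consCoord (0, x)

theorem exists_rotation_eq_coord (g : EuclideanSpace ℝ (Fin (d + 1)) →L[ℝ] ℝ) :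
    ∃ (R : EuclideanSpace ℝ (Fin (d + 1)) ≃ₗᵢ[ℝ] EuclideanSpace ℝ (Fin (d + 1))) (c : ℝ),
      ∀ x, g (R x) = c * x 0 := by
  set w := (InnerProductSpace.toDual ℝ _).symm g
  have hg : ∀ x, g x = inner ℝ w x := fun x => (InnerProductSpace.toDual_symm_apply).symm
  by_cases hw : w = 0
  · exact ⟨LinearIsometryEquiv.refl ℝ _, 0, fun x => by simp [hg, hw]⟩
  · have hunit : Orthonormal ℝ (({0} : Set (Fin (d + 1))).domRestrict fun _ => ‖w‖⁻¹ • w) :=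
      ⟨fun _ => by simp [norm_smul, hw],
        fun i j hij => absurd (Subtype.ext (i.2.trans j.2.symm)) hij⟩
    obtain ⟨b, hb⟩ := hunit.exists_orthonormalBasis_extension_of_card_eq (by simp)
    have hwb : w = ‖w‖ • b 0 := by
      rw [hb 0 rfl, smul_inv_smul₀ (norm_ne_zero_iff.2 hw)]
    refine ⟨b.repr.symm, ‖w‖, fun x => ?_⟩
    rw [hg]
    conv_lhs => rw [hwb]
    rw [real_inner_smul_left, ← b.repr_apply_apply, LinearIsometryEquiv.apply_symm_apply]

end ConsCoord

/-- A `d`-dimensional affine subspace of `F`, with its point closest to the origin and an isometric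
parametrization of its direction. -/
structure AffineSlice (F : Type*) [NormedAddCommGroup F] [InnerProductSpace ℝ F] (d : ℕ) where
  base : F
  dir : EuclideanSpace ℝ (Fin d) →ₗᵢ[ℝ] F
  inner_base_dir : ∀ x, inner ℝ base (dir x) = 0

namespace AffineSlice

variable {F : Type*} [NormedAddCommGroup F] [InnerProductSpace ℝ F] {d : ℕ}

/-- The point of the slice with parameter `x`. -/
noncomputable def point (P : AffineSlice F d) (x : EuclideanSpace ℝ (Fin d)) : F := P.base + P.dir x

/-- The linear subspace parametrized by `A`. -/
noncomputable def ofIsometry (A : EuclideanSpace ℝ (Fin d) →ₗᵢ[ℝ] F) : AffineSlice F d :=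
  ⟨0, A, by simp⟩

theorem point_ofIsometry (A : EuclideanSpace ℝ (Fin d) →ₗᵢ[ℝ] F) (x : EuclideanSpace ℝ (Fin d)) :
    (ofIsometry A).point x = A x := zero_add _

theorem norm_sq_point (P : AffineSlice F d) (x : EuclideanSpace ℝ (Fin d)) :
    ‖P.point x‖ ^ 2 = ‖P.base‖ ^ 2 + ‖x‖ ^ 2 := by
  rw [point, norm_add_sq_real, P.inner_base_dir, P.dir.norm_map]
  ring

theorem continuous_point (P : AffineSlice F d) : Continuous P.point :=
  continuous_const.add P.dir.continuous

variable (P : AffineSlice F (d + 1))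
  (R : EuclideanSpace ℝ (Fin (d + 1)) ≃ₗᵢ[ℝ] EuclideanSpace ℝ (Fin (d + 1)))

/-- The slice of the points of `P` whose first coordinate, after the rotation `R` of the parameter
space, is `t`. -/
noncomputable def cut (t : ℝ) : AffineSlice F d where
  base := P.point (R (consCoord (t, 0)))
  dir := P.dir.comp (R.toLinearIsometry.comp (consZero d))
  inner_base_dir z := by
    change inner ℝ (P.base + P.dir (R (consCoord (t, 0)))) (P.dir (R (consCoord (0, z)))) = 0
    rw [inner_add_left, P.inner_base_dir, P.dir.inner_map_map, R.inner_map_map, inner_consCoord,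
      add_zero]

theorem point_cut (t : ℝ) (z : EuclideanSpace ℝ (Fin d)) :
    (P.cut R t).point z = P.point (R (consCoord (t, z))) := by
  change P.base + P.dir (R (consCoord (t, 0))) + P.dir (R (consCoord (0, z))) = _
  rw [consCoord_eq_add t z, map_add, point, map_add, add_assoc]

theorem measurable_lintegral_cut {φ : F → ℝ≥0∞} (hφ : Measurable fun x => φ (P.point x)) :
    Measurable fun t => ∫⁻ z, φ ((P.cut R t).point z) := by
  simp only [point_cut]
  exact (hφ.comp (R.measurePreserving.comp
    measurePreserving_consCoord).measurable).lintegral_prod_right'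

theorem lintegral_point_eq_cut {φ : F → ℝ≥0∞} (hφ : Measurable fun x => φ (P.point x)) :
    ∫⁻ x, φ (P.point x) = ∫⁻ t, ∫⁻ z, φ ((P.cut R t).point z) := by
  have hR := R.measurePreserving.comp (measurePreserving_consCoord (d := d))
  simp only [point_cut]
  rw [← hR.lintegral_comp hφ]
  exact lintegral_prod _ (hφ.comp hR.measurable).aemeasurable

end AffineSlice

section SymmetricBall

variable {E G : Type*} [NormedAddCommGroup E] [NormedSpace ℝ E] [MeasurableSpace E] [BorelSpace E]
  [NormedAddCommGroup G] [NormedSpace ℝ G]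

theorem two_mul_enorm_sq_le (a b : G) : 2 * ‖b‖ₑ ^ 2 ≤ ‖a + b‖ₑ ^ 2 + ‖a - b‖ₑ ^ 2 := by
  have hnorm : 2 * ‖b‖ ≤ ‖a + b‖ + ‖a - b‖ := by
    calc 2 * ‖b‖ = ‖(a + b) - (a - b)‖ := by
          rw [add_sub_sub_cancel, ← two_smul ℝ b, norm_smul, Real.norm_two]
      _ ≤ _ := norm_sub_le _ _
  have hsq : 2 * ‖b‖ ^ 2 ≤ ‖a + b‖ ^ 2 + ‖a - b‖ ^ 2 := by
    nlinarith [sq_nonneg (‖a + b‖ - ‖a - b‖), norm_nonneg b]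
  simp only [← ofReal_norm, ← ENNReal.ofReal_pow (norm_nonneg _)]
  rw [← ENNReal.ofReal_add (by positivity) (by positivity), ← ENNReal.ofReal_ofNat,
    ← ENNReal.ofReal_mul (by norm_num)]
  exact ENNReal.ofReal_le_ofReal hsq

/-- Pair each point of the ball with its antipode. -/
theorem sq_mul_lintegral_norm_sq_le (μ : Measure E) [μ.IsNegInvariant] {s : ℝ≥0} {B : E →L[ℝ] G}
    (hB : ∀ x, s * ‖x‖ ≤ ‖B x‖) (u : G) (r : ℝ) :
    (s : ℝ≥0∞) ^ 2 * ∫⁻ x in {x : E | ‖x‖ ^ 2 ≤ r}, ENNReal.ofReal (‖x‖ ^ 2) ∂μ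
      ≤ ∫⁻ x in {x : E | ‖x‖ ^ 2 ≤ r}, ‖u + B x‖ₑ ^ 2 ∂μ := by
  set D : Set E := {x | ‖x‖ ^ 2 ≤ r}
  have hD : MeasurableSet D := measurableSet_le (by fun_prop) measurable_const
  have hmeas : Measurable fun x => ‖u + B x‖ₑ ^ 2 :=
    (by fun_prop : Continuous fun x => ‖u + B x‖ₑ ^ 2).measurable
  have hneg : ∫⁻ x in D, ‖u + B x‖ₑ ^ 2 ∂μ = ∫⁻ x in D, ‖u - B x‖ₑ ^ 2 ∂μ := by
    rw [← lintegral_indicator hD, ← lintegral_indicator hD,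
      ← (Measure.measurePreserving_neg μ).lintegral_comp (hmeas.indicator hD)]
    refine lintegral_congr fun x => ?_
    simp [D, Set.indicator, sub_eq_add_neg]
  have hpoint : ∀ x, 2 * ((s : ℝ≥0∞) ^ 2 * ENNReal.ofReal (‖x‖ ^ 2))
      ≤ ‖u + B x‖ₑ ^ 2 + ‖u - B x‖ₑ ^ 2 := fun x => by
    refine le_trans ?_ (two_mul_enorm_sq_le u (B x))
    rw [ENNReal.ofReal_pow (norm_nonneg x), ← mul_pow, ofReal_norm]
    gcongr
    simp only [enorm_eq_nnnorm]
    exact_mod_cast hB x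
  refine (ENNReal.mul_le_mul_iff_right two_ne_zero ENNReal.ofNat_ne_top).1 ?_
  calc 2 * ((s : ℝ≥0∞) ^ 2 * ∫⁻ x in D, ENNReal.ofReal (‖x‖ ^ 2) ∂μ)
      = ∫⁻ x in D, 2 * ((s : ℝ≥0∞) ^ 2 * ENNReal.ofReal (‖x‖ ^ 2)) ∂μ := by
        rw [lintegral_const_mul' _ _ (by simp), lintegral_const_mul' _ _ (by simp)]
    _ ≤ ∫⁻ x in D, (‖u + B x‖ₑ ^ 2 + ‖u - B x‖ₑ ^ 2) ∂μ := lintegral_mono hpoint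
    _ = 2 * ∫⁻ x in D, ‖u + B x‖ₑ ^ 2 ∂μ := by
        rw [lintegral_add_left hmeas, ← hneg, two_mul]

end SymmetricBall

section TradeOff

variable {F G : Type*} [NormedAddCommGroup F] [InnerProductSpace ℝ F]
  [NormedAddCommGroup G] [NormedSpace ℝ G]

/-- The weight `1 - ‖f‖²` on the unit ball, extended by zero: observations are counted with
respect to it, because its integral over a slice measures the error of a constant on the slice. -/
noncomputable def ballWeight (f : F) : ℝ≥0∞ := ENNReal.ofReal (1 - ‖f‖ ^ 2)

/-- The squared error at `f` for the noise `ω` if `f` is in the unit ball, and zero otherwise. -/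
noncomputable def ballErr (S : F →L[ℝ] G) (N : AdaptiveInfo F) (Φ : Algorithm G) (ω : ℕ → ℝ)
    (f : F) : ℝ≥0∞ :=
  Set.indicator {f | ‖f‖ ^ 2 ≤ 1} (fun f => ‖S f - output N Φ f ω‖ₑ ^ 2) f

namespace AffineSlice

variable {d : ℕ}

theorem measurable_ballWeight (P : AffineSlice F d) : Measurable fun x => ballWeight (P.point x) :=
  (by have := P.continuous_point; fun_prop :
    Continuous fun x => 1 - ‖P.point x‖ ^ 2).measurable.ennreal_ofReal

variable {N : AdaptiveInfo F} {Φ : Algorithm G}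

section Measurability

variable {X : Type*} [MeasurableSpace X] {x : X → EuclideanSpace ℝ (Fin d)} {w : X → ℕ → ℝ}

theorem measurable_numObs_point (P : AffineSlice F d) (hN : N.IsMeasurable) (hx : Measurable x)
    (hw : Measurable w) : Measurable fun p => (N.numObs (P.point (x p)) (w p) : ℝ≥0∞) :=
  (measurable_of_countable fun n : ℕ => (n : ℝ≥0∞)).comp (hN.measurable_numObs
    ((hN.measurableEval_const P.base).add (hN.measurableEval_linearMap P.dir.toLinearMap hx)) hw)

theorem measurable_ballErr (P : AffineSlice F d) (S : F →L[ℝ] G) (hN : N.IsMeasurable)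
    (hΦ : ∀ n, StronglyMeasurable (Φ n)) (hx : Measurable x) (hw : Measurable w) :
    Measurable fun p => ballErr S N Φ (w p) (P.point (x p)) := by
  have hball : MeasurableSet {p | ‖P.point (x p)‖ ^ 2 ≤ 1} :=
    measurableSet_le ((P.continuous_point.norm.pow 2).measurable.comp hx) measurable_const
  have hS : StronglyMeasurable fun p => S (P.point (x p)) :=
    (S.continuous.comp P.continuous_point).stronglyMeasurable.comp_measurable hx
  exact ((hN.measurable_enorm_sub_output ((hN.measurableEval_const P.base).add
    (hN.measurableEval_linearMap P.dir.toLinearMap hx)) hw hΦ hS).pow_const 2).indicator hball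

end Measurability

/-- The trade-off between error and number of observations on the part of the unit ball in a slice
on which `k` observations have already been used and are constant: every further observation
reduces the dimension at most by one. The number `s` is a lower bound for `S` on the slice. -/
def TradeOff (P : AffineSlice F d) (S : F →L[ℝ] G) (N : AdaptiveInfo F) (Φ : Algorithm G)
    (ω : ℕ → ℝ) (s : ℝ≥0) (k : ℕ) : Prop :=
  (s : ℝ≥0∞) ^ 2 * (d + k) * ∫⁻ x, ballWeight (P.point x)
    ≤ 2 * (∫⁻ x, ballErr S N Φ ω (P.point x)) +
      (s : ℝ≥0∞) ^ 2 * ∫⁻ x, ballWeight (P.point x) * N.numObs (P.point x) ω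

variable {S : F →L[ℝ] G} {ω : ℕ → ℝ} {s : ℝ≥0} {k : ℕ}

theorem TradeOff.of_succ {P : AffineSlice F d} (h : P.TradeOff S N Φ ω s (k + 1)) :
    P.TradeOff S N Φ ω s k := by
  refine le_trans ?_ h
  gcongr
  exact k.le_succ

theorem TradeOff.of_terminated {P : AffineSlice F d} (hS : ∀ x, s * ‖x‖ ≤ ‖S (P.dir x)‖)
    {y : Fin k → ℝ} (hobs : ∀ x, N.obs (P.point x) ω k = y) (hy : y ∈ N.Y k) :
    P.TradeOff S N Φ ω s k := by
  have hnum : ∀ x, N.numObs (P.point x) ω = k := fun x =>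
    N.numObs_eq_iff.2 ((hobs x).symm ▸ hy)
  have hout : ∀ x, output N Φ (P.point x) ω = Φ k y := fun x => by rw [output, hnum, hobs]
  have hweight : ∀ x, ballWeight (P.point x) = ENNReal.ofReal (1 - ‖P.base‖ ^ 2 - ‖x‖ ^ 2) :=
    fun x => by rw [ballWeight, P.norm_sq_point, sub_sub]
  have hball : MeasurableSet {x : EuclideanSpace ℝ (Fin d) | ‖x‖ ^ 2 ≤ 1 - ‖P.base‖ ^ 2} :=
    measurableSet_le (by fun_prop) measurable_const
  have herr : ∫⁻ x, ballErr S N Φ ω (P.point x)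
      = ∫⁻ x in {x | ‖x‖ ^ 2 ≤ 1 - ‖P.base‖ ^ 2},
        ‖(S P.base - Φ k y) + S.comp P.dir.toContinuousLinearMap x‖ₑ ^ 2 := by
    rw [← lintegral_indicator hball]
    refine lintegral_congr fun x => ?_
    simp only [ballErr, Set.indicator, Set.mem_ofPred_eq, P.norm_sq_point, hout,
      le_sub_iff_add_le']
    congr 3
    simp only [point, map_add, ContinuousLinearMap.comp_apply,
      LinearIsometry.coe_toContinuousLinearMap]
    abel
  have hdim := two_mul_lintegral_norm_sq_le (volume : Measure (EuclideanSpace ℝ (Fin d)))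
    (1 - ‖P.base‖ ^ 2)
  rw [finrank_euclideanSpace_fin] at hdim
  simp only [TradeOff, hnum, hweight]
  rw [lintegral_mul_const' _ _ (by simp), mul_add, add_mul, mul_assoc, ← hdim, herr, mul_left_comm]
  refine add_le_add ?_ (le_of_eq (by ring))
  gcongr
  exact sq_mul_lintegral_norm_sq_le volume (B := S.comp P.dir.toContinuousLinearMap) hS _ _

theorem TradeOff.of_cut {P : AffineSlice F (d + 1)} (hN : N.IsMeasurable)
    (hΦ : ∀ n, StronglyMeasurable (Φ n))
    (R : EuclideanSpace ℝ (Fin (d + 1)) ≃ₗᵢ[ℝ] EuclideanSpace ℝ (Fin (d + 1)))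
    (h : ∀ t, (P.cut R t).TradeOff S N Φ ω s (k + 1)) : P.TradeOff S N Φ ω s k := by
  have hw := P.measurable_ballWeight
  have he : Measurable fun x => ballErr S N Φ ω (P.point x) :=
    P.measurable_ballErr S hN hΦ measurable_id measurable_const
  have hn : Measurable fun x => ballWeight (P.point x) * N.numObs (P.point x) ω :=
    hw.mul (P.measurable_numObs_point hN measurable_id measurable_const)
  rw [TradeOff, P.lintegral_point_eq_cut R hw, P.lintegral_point_eq_cut R he,
    P.lintegral_point_eq_cut R (φ := fun f => ballWeight f * N.numObs f ω) hn,
    ← lintegral_const_mul' _ _ (by finiteness), ← lintegral_const_mul' _ _ (by finiteness),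
    ← lintegral_const_mul' _ _ (by finiteness),
    ← lintegral_add_left ((P.measurable_lintegral_cut R he).const_mul _)]
  refine lintegral_mono fun t => le_trans (le_of_eq ?_) (h t)
  push_cast
  ring

theorem TradeOff.of_obs_eq (hN : N.IsMeasurable) (hΦ : ∀ n, StronglyMeasurable (Φ n))
    (P : AffineSlice F d) (hS : ∀ x, s * ‖x‖ ≤ ‖S (P.dir x)‖)
    (hobs : ∀ x, N.obs (P.point x) ω k = N.obs P.base ω k) (hk : k ≤ N.numObs P.base ω) :
    P.TradeOff S N Φ ω s k := by
  induction d using Nat.strong_induction_on generalizing k with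
  | _ d ih =>
  obtain ⟨j, hj⟩ := Nat.exists_eq_add_of_le hk
  induction j generalizing k with
  | zero => exact .of_terminated hS hobs (N.numObs_eq_iff.1 hj)
  | succ j ihj =>
    set ℓ := N.L k (N.obs P.base ω k)
    by_cases hℓ : ∀ x, ℓ (P.dir x) = 0
    · refine .of_succ (ihj (fun x => N.obs_succ_congr (hobs x) ?_) (by omega) (by omega))
      change ℓ (P.base + P.dir x) = ℓ P.base
      rw [map_add, hℓ, add_zero]
    obtain _ | d := d
    · exact absurd (fun x => by rw [Subsingleton.elim x 0, map_zero, map_zero]) hℓ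
    -- The level sets of the next functional `ℓ` are slices of the next lower dimension.
    obtain ⟨R, c, hR⟩ := exists_rotation_eq_coord (ℓ.comp P.dir.toContinuousLinearMap)
    have hcoord : ∀ t z, ℓ ((P.cut R t).point z) = ℓ P.base + c * t := fun t z => by
      rw [P.point_cut, point, map_add]
      exact congrArg (ℓ P.base + ·) (hR (consCoord (t, z)))
    have hcut : ∀ t z, N.obs ((P.cut R t).point z) ω k = N.obs P.base ω k := fun t z =>
      P.point_cut R t z ▸ hobs _
    have hbase : ∀ t, (P.cut R t).base = (P.cut R t).point 0 := fun t => by simp [point]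
    refine .of_cut hN hΦ R fun t => ih d d.lt_succ_self (P.cut R t) (fun z => ?_) (fun z => ?_) ?_
    · have hz := hS (R (consZero d z))
      rwa [R.norm_map, (consZero d).norm_map] at hz
    · rw [hbase]
      refine N.obs_succ_congr ((hcut t z).trans (hcut t 0).symm) ?_
      rw [hcut t 0, hcoord, hcoord]
    · rw [hbase]
      exact N.lt_numObs_of_obs_eq (hcut t 0).symm (by omega)

theorem lintegral_tradeOff (hN : N.IsMeasurable) (hΦ : ∀ n, StronglyMeasurable (Φ n))
    (P : AffineSlice F d) (hS : ∀ x, s * ‖x‖ ≤ ‖S (P.dir x)‖) :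
    (s : ℝ≥0∞) ^ 2 * d * ∫⁻ x, ballWeight (P.point x)
      ≤ 2 * (∫⁻ x, ∫⁻ ω, ballErr S N Φ ω (P.point x) ∂stdNoise) + (s : ℝ≥0∞) ^ 2 *
        ∫⁻ x, ∫⁻ ω, ballWeight (P.point x) * N.numObs (P.point x) ω ∂stdNoise := by
  have he : Measurable fun p : EuclideanSpace ℝ (Fin d) × (ℕ → ℝ) =>
      ballErr S N Φ p.2 (P.point p.1) := P.measurable_ballErr S hN hΦ measurable_fst measurable_snd
  have hn : Measurable fun p : EuclideanSpace ℝ (Fin d) × (ℕ → ℝ) =>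
      ballWeight (P.point p.1) * N.numObs (P.point p.1) p.2 :=
    (P.measurable_ballWeight.comp measurable_fst).mul
      (P.measurable_numObs_point hN measurable_fst measurable_snd)
  have hfixed : ∀ ω, P.TradeOff S N Φ ω s 0 := fun ω =>
    .of_obs_eq hN hΦ P hS (fun _ => rfl) (Nat.zero_le _)
  simp only [TradeOff, Nat.cast_zero, add_zero] at hfixed
  rw [lintegral_lintegral_swap (f := fun x ω => ballErr S N Φ ω (P.point x)) he.aemeasurable,
    lintegral_lintegral_swap (f := fun x ω => ballWeight (P.point x) * N.numObs (P.point x) ω)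
      hn.aemeasurable]
  calc (s : ℝ≥0∞) ^ 2 * d * ∫⁻ x, ballWeight (P.point x)
      = ∫⁻ _, ((s : ℝ≥0∞) ^ 2 * d * ∫⁻ x, ballWeight (P.point x)) ∂stdNoise := by
        rw [lintegral_const, measure_univ, mul_one]
    _ ≤ _ := lintegral_mono hfixed
    _ = _ := by
        rw [lintegral_add_left (he.lintegral_prod_left'.const_mul _),
          lintegral_const_mul' _ _ (by finiteness), lintegral_const_mul' _ _ (by finiteness)]

end AffineSlice

variable {N : AdaptiveInfo F}

theorem lintegral_ballErr_le {S : F →L[ℝ] G} {Φ : Algorithm G} {r : ℝ≥0∞}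
    (h : errWA S (Metric.closedBall 0 1) N Φ ≤ r) (f : F) :
    ∫⁻ ω, ballErr S N Φ ω f ∂stdNoise ≤ (Metric.closedBall 0 1).indicator (fun _ => r ^ 2) f := by
  by_cases hf : ‖f‖ ≤ 1
  · simpa [ballErr, Set.indicator, hf] using lintegral_sq_le_of_errWA_le h (by simpa using hf)
  · simp [ballErr, Set.indicator, hf]

theorem lintegral_ballWeight_mul_numObs_le {cost : ℝ≥0 → ℝ≥0∞} (hc : ∀ σ, 1 ≤ cost σ) (f : F) :
    ∫⁻ ω, ballWeight f * N.numObs f ω ∂stdNoise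
      ≤ ballWeight f * costWA cost (Metric.closedBall 0 1) N := by
  rw [lintegral_const_mul' _ _ (by simp [ballWeight])]
  by_cases hf : ‖f‖ ≤ 1
  · gcongr
    exact lintegral_numObs_le_costWA hc N (by simpa using hf)
  · have hzero : ballWeight f = 0 :=
      ENNReal.ofReal_eq_zero.2 (by nlinarith [norm_nonneg f])
    simp [hzero]

theorem four_mul_finrank_le_add_costWA {S : F →L[ℝ] G} {Φ : Algorithm G} (hN : N.IsMeasurable)
    (hΦ : ∀ n, StronglyMeasurable (Φ n)) {cost : ℝ≥0 → ℝ≥0∞} (hc : ∀ σ, 1 ≤ cost σ) {r : ℝ≥0}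
    (hr : r ≠ 0) (herr : errWA S (Metric.closedBall 0 1) N Φ ≤ r) (V : Submodule ℝ F)
    [FiniteDimensional ℝ V] (hV : ∀ x ∈ V, 2 * r * ‖x‖ ≤ ‖S x‖) :
    (4 * Module.finrank ℝ V : ℝ≥0∞)
      ≤ Module.finrank ℝ V + 2 + 4 * costWA cost (Metric.closedBall 0 1) N := by
  set m := Module.finrank ℝ V
  set C := costWA cost (Metric.closedBall 0 1) N
  set A := V.subtypeₗᵢ.comp (stdOrthonormalBasis ℝ V).repr.symm.toLinearIsometry
  set H := ∫⁻ x : EuclideanSpace ℝ (Fin m), ENNReal.ofReal (1 - ‖x‖ ^ 2)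
  have hweight : ∀ x, ballWeight (A x) = ENNReal.ofReal (1 - ‖x‖ ^ 2) := fun x => by
    rw [ballWeight, A.norm_map]
  have htrade := (AffineSlice.ofIsometry A).lintegral_tradeOff (s := 2 * r) hN hΦ fun x => by
    rw [← A.norm_map x]
    exact hV (A x) (SetLike.coe_mem _)
  simp only [AffineSlice.point_ofIsometry, hweight] at htrade
  have herror : ∫⁻ x, ∫⁻ ω, ballErr S N Φ ω (A x) ∂stdNoise
      ≤ (r : ℝ≥0∞) ^ 2 * volume (Metric.closedBall (0 : EuclideanSpace ℝ (Fin m)) 1) := by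
    rw [← setLIntegral_const, ← lintegral_indicator Metric.isClosed_closedBall.measurableSet]
    refine lintegral_mono fun x => (lintegral_ballErr_le herr (A x)).trans_eq ?_
    simp [Set.indicator]
  have hnumber : ∫⁻ x, ∫⁻ ω, ENNReal.ofReal (1 - ‖x‖ ^ 2) * N.numObs (A x) ω ∂stdNoise
      ≤ H * C := by
    rw [← lintegral_mul_const _ (by fun_prop)]
    refine lintegral_mono fun x => ?_
    simpa only [hweight] using lintegral_ballWeight_mul_numObs_le hc (A x)
  have hvol := two_mul_measure_closedBall (volume : Measure (EuclideanSpace ℝ (Fin m)))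
  rw [finrank_euclideanSpace_fin] at hvol
  refine (ENNReal.mul_le_mul_iff_right (a := (r : ℝ≥0∞) ^ 2 * H)
    (mul_ne_zero (by simpa using hr) (lintegral_one_sub_norm_sq_ne_zero volume))
    (ENNReal.mul_ne_top (by finiteness) (lintegral_one_sub_norm_sq_ne_top volume))).1 ?_
  calc (r : ℝ≥0∞) ^ 2 * H * (4 * m) = ((2 * r : ℝ≥0) : ℝ≥0∞) ^ 2 * m * H := by push_cast; ring
    _ ≤ 2 * ((r : ℝ≥0∞) ^ 2 * volume (Metric.closedBall (0 : EuclideanSpace ℝ (Fin m)) 1))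
        + ((2 * r : ℝ≥0) : ℝ≥0∞) ^ 2 * (H * C) := htrade.trans (by gcongr)
    _ = (r : ℝ≥0∞) ^ 2 * H * (m + 2 + 4 * C) := by
        rw [mul_left_comm, hvol]
        push_cast
        ring

end TradeOff

section NormedSpace

variable {F G : Type*} [NormedAddCommGroup F] [NormedSpace ℝ F]
  [NormedAddCommGroup G] [NormedSpace ℝ G]

theorem one_le_costWA {S : F →L[ℝ] G} {N : AdaptiveInfo F} {Φ : Algorithm G}
    {cost : ℝ≥0 → ℝ≥0∞} (hc : ∀ σ, 1 ≤ cost σ) {r : ℝ≥0} (hr : r < ‖S‖)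
    (herr : errWA S (Metric.closedBall 0 1) N Φ ≤ r) :
    1 ≤ costWA cost (Metric.closedBall 0 1) N := by
  by_cases h0 : (Fin.elim0 : Fin 0 → ℝ) ∈ N.Y 0
  · have hle : ∀ f : F, ‖f‖ ≤ 1 → ‖S f - Φ 0 Fin.elim0‖ₑ ^ 2 ≤ (r : ℝ≥0∞) ^ 2 := fun f hf => by
      have hout : ∀ ω, output N Φ f ω = Φ 0 Fin.elim0 := fun ω => by
        rw [output, N.numObs_eq_iff.2 h0, AdaptiveInfo.obs]
      simpa [hout] using lintegral_sq_le_of_errWA_le herr (f := f) (by simpa using hf)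
    refine absurd (S.opNorm_le_of_unit_norm r.coe_nonneg fun f hf => ?_) hr.not_ge
    have hsq : 2 * ‖S f‖ₑ ^ 2 ≤ 2 * (r : ℝ≥0∞) ^ 2 := by
      calc 2 * ‖S f‖ₑ ^ 2 ≤ ‖-Φ 0 Fin.elim0 + S f‖ₑ ^ 2 + ‖-Φ 0 Fin.elim0 - S f‖ₑ ^ 2 :=
            two_mul_enorm_sq_le _ _
        _ = ‖S f - Φ 0 Fin.elim0‖ₑ ^ 2 + ‖S (-f) - Φ 0 Fin.elim0‖ₑ ^ 2 := by
            rw [map_neg, neg_add_eq_sub, neg_sub_comm]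
        _ ≤ 2 * (r : ℝ≥0∞) ^ 2 := by
            rw [two_mul]
            exact add_le_add (hle f hf.le) (hle (-f) (by rw [norm_neg, hf]))
    have hle' := (ENNReal.pow_le_pow_left_iff two_ne_zero).1
      ((ENNReal.mul_le_mul_iff_right two_ne_zero ENNReal.ofNat_ne_top).1 hsq)
    rw [enorm_eq_nnnorm] at hle'
    exact_mod_cast hle'
  · refine le_trans ?_ (lintegral_numObs_le_costWA hc N (f := 0) (by simp))
    have hpos : ∀ ω, (1 : ℝ≥0∞) ≤ N.numObs 0 ω := fun ω => by
      have hne : N.numObs 0 ω ≠ 0 := fun h => h0 (N.numObs_eq_iff.1 h)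
      exact_mod_cast Nat.one_le_iff_ne_zero.2 hne
    calc (1 : ℝ≥0∞) = ∫⁻ _, 1 ∂stdNoise := by simp
      _ ≤ _ := lintegral_mono hpos

end NormedSpace

variable {F G : Type*} [NormedAddCommGroup F] [InnerProductSpace ℝ F] [NormedAddCommGroup G]

theorem nWorst_le_finrank [NormedSpace ℝ G] {S : F →L[ℝ] G} {ε : ℝ≥0} (U : Submodule ℝ F)
    [FiniteDimensional ℝ U] (hU : ∀ x ∈ Uᗮ, ‖S x‖ ≤ ε * ‖S‖ * ‖x‖) :
    nWorst S ε ≤ Module.finrank ℝ U := by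
  set b := stdOrthonormalBasis ℝ U
  set ℓ : ℕ → F →L[ℝ] ℝ := fun i =>
    if h : i < Module.finrank ℝ U then innerSL ℝ (b ⟨i, h⟩ : F) else 0
  have hℓ : ∀ i, ‖ℓ i‖ ≤ 1 := fun i => by
    by_cases h : i < Module.finrank ℝ U
    · simp only [ℓ, h, dite_true, innerSL_apply_norm]
      exact (b.norm_eq_one ⟨i, h⟩).le
    · simp [ℓ, h]
  set N := AdaptiveInfo.nonadaptive ℓ hℓ fun _ : Fin (Module.finrank ℝ U) => 0
  set Φ : Algorithm G := fun n y => ∑ i : Fin n,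
    if h : i < Module.finrank ℝ U then y i • S (b ⟨i, h⟩) else 0
  have hout : ∀ f, output N Φ f 0 = S (U.starProjection f) := fun f => by
    simp [N, Φ, ℓ, AdaptiveInfo.output_nonadaptive, b.starProjection_eq_sum_rankOne]
  refine sInf_le_of_le ⟨N, Φ, fun i y => by simp [N, AdaptiveInfo.nonadaptive],
    iSup₂_le fun f hf => ?_, rfl⟩ (iSup₂_le fun f _ => ?_)
  · rw [hout, ← map_sub, enorm_le_coe_mul_enorm_iff, ← U.starProjection_orthogonal_val]
    calc ‖S (Uᗮ.starProjection f)‖ ≤ ε * ‖S‖ * ‖Uᗮ.starProjection f‖ :=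
          hU _ (Uᗮ.starProjection_apply_mem f)
      _ ≤ ε * ‖S‖ := mul_le_of_le_one_right (by positivity)
          ((Uᗮ.norm_starProjection_apply_le f).trans (by simpa using hf))
  · rw [AdaptiveInfo.numObs_nonadaptive]

/-- The inertia of the quadratic form `‖S x‖² - s² ‖x‖²`: the space `U` consists of the Riesz
representatives of the functionals which the form associates with the elements of `V`. -/
theorem exists_gt_le_norm_map_or_norm_map_le_on_orthogonal [InnerProductSpace ℝ G]
    [CompleteSpace F] (S : F →L[ℝ] G) {s : ℝ} (hs : 0 ≤ s) (V : Submodule ℝ F)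
    [FiniteDimensional ℝ V] (hV : ∀ x ∈ V, s * ‖x‖ ≤ ‖S x‖) :
    (∃ V' > V, FiniteDimensional ℝ V' ∧ ∀ x ∈ V', s * ‖x‖ ≤ ‖S x‖) ∨
      ∃ U : Submodule ℝ F, FiniteDimensional ℝ U ∧ Module.finrank ℝ U ≤ Module.finrank ℝ V ∧
        ∀ x ∈ Uᗮ, ‖S x‖ ≤ s * ‖x‖ := by
  set T := InnerProductSpace.continuousLinearMapOfBilin
    ((innerSL ℝ).bilinearComp S S - s ^ 2 • innerSL ℝ)
  have hT : ∀ v x, inner ℝ (T v) x = inner ℝ (S v) (S x) - s ^ 2 * inner ℝ v x := fun v x => by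
    simp [T]
  refine or_iff_not_imp_right.2 fun hU => ?_
  push Not at hU
  obtain ⟨x, hx, hlt⟩ := hU (V.map T.toLinearMap) inferInstance (Submodule.finrank_map_le _ _)
  have horth : ∀ v ∈ V, inner ℝ (S v) (S x) = s ^ 2 * inner ℝ v x := fun v hv => by
    have h := hx (T v) (Submodule.mem_map_of_mem hv)
    rwa [hT, sub_eq_zero] at h
  have hxV : x ∉ V := fun hmem => by
    have h := horth x hmem
    rw [real_inner_self_eq_norm_sq, real_inner_self_eq_norm_sq, ← mul_pow] at h
    exact hlt.ne' ((sq_eq_sq₀ (norm_nonneg _) (by positivity)).1 h)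
  refine ⟨V ⊔ Submodule.span ℝ {x}, lt_of_le_of_ne le_sup_left fun h => hxV ?_, inferInstance,
    fun z hz => ?_⟩
  · rw [h]
    exact Submodule.mem_sup_right (Submodule.mem_span_singleton_self x)
  · obtain ⟨v, hv, w, hw, rfl⟩ := Submodule.mem_sup.1 hz
    obtain ⟨a, rfl⟩ := Submodule.mem_span_singleton.1 hw
    have hv2 : (s * ‖v‖) ^ 2 ≤ ‖S v‖ ^ 2 := by gcongr; exact hV v hv
    have hx2 : a ^ 2 * (s * ‖x‖) ^ 2 ≤ a ^ 2 * ‖S x‖ ^ 2 := by gcongr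
    rw [← sq_le_sq₀ (by positivity) (by positivity), mul_pow, map_add, norm_add_sq_real,
      norm_add_sq_real, map_smul, real_inner_smul_right, real_inner_smul_right, horth v hv,
      norm_smul, norm_smul, Real.norm_eq_abs, mul_pow, mul_pow, sq_abs]
    linarith

theorem nWorst_le_of_forall_finrank_le [InnerProductSpace ℝ G] [CompleteSpace F] {S : F →L[ℝ] G}
    {ε : ℝ≥0} {B : ℕ} (h : ∀ (V : Submodule ℝ F) [FiniteDimensional ℝ V],
      (∀ x ∈ V, ε * ‖S‖ * ‖x‖ ≤ ‖S x‖) → Module.finrank ℝ V ≤ B) : nWorst S ε ≤ B := by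
  by_contra hB
  have hlarge : ∀ n : ℕ, ∃ V : Submodule ℝ F, FiniteDimensional ℝ V ∧
      (∀ x ∈ V, ε * ‖S‖ * ‖x‖ ≤ ‖S x‖) ∧ n ≤ Module.finrank ℝ V := fun n => by
    induction n with
    | zero => exact ⟨⊥, inferInstance, by simp, Nat.zero_le _⟩
    | succ n ih =>
      obtain ⟨V, hfin, hV, hn⟩ := ih
      obtain ⟨V', hlt, hfin', hV'⟩ | ⟨U, hfinU, hUV, hU⟩ :=
        exists_gt_le_norm_map_or_norm_map_le_on_orthogonal S (by positivity) V hV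
      · exact ⟨V', hfin', hV', hn.trans_lt (Submodule.finrank_lt_finrank_of_lt hlt)⟩
      · exact absurd ((nWorst_le_finrank U hU).trans (by exact_mod_cast hUV.trans (h V hV))) hB
  obtain ⟨V, hfin, hV, hn⟩ := hlarge (B + 1)
  exact (h V hV).not_gt hn

theorem nWorst_add_one_div_four_le_compWA [InnerProductSpace ℝ G] [CompleteSpace F]
    {S : F →L[ℝ] G} (hS : S ≠ 0) {cost : ℝ≥0 → ℝ≥0∞} (hc : ∀ σ, 1 ≤ cost σ) {ε : ℝ≥0}
    (hε0 : 0 < ε) (hε1 : ε < 1) : (nWorst S (2 * ε) + 1) / 4 ≤ compWA cost S ε := by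
  have hS0 : 0 < ‖S‖₊ := nnnorm_pos.2 hS
  refine le_sInf ?_
  rintro _ ⟨N, Φ, hN, hΦ, herr, rfl⟩
  rw [enorm_eq_nnnorm, ← ENNReal.coe_mul] at herr
  have hC := one_le_costWA hc (mul_lt_of_lt_one_left hS0 hε1) herr
  have hdim := four_mul_finrank_le_add_costWA hN hΦ hc (mul_pos hε0 hS0).ne' herr
  generalize costWA cost (Metric.closedBall (0 : F) 1) N = C at hC hdim ⊢
  rw [ENNReal.div_le_iff (by simp) (by simp)]
  induction C using ENNReal.recTopCoe with
  | top => simp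
  | coe C =>
    set B := ⌊(2 + 4 * C) / 3⌋₊
    have hn : nWorst S (2 * ε) ≤ B := nWorst_le_of_forall_finrank_le fun V _ hV => by
      have hVC : 4 * (Module.finrank ℝ V : ℝ≥0) ≤ Module.finrank ℝ V + 2 + 4 * C := by
        exact_mod_cast hdim V (by simpa [mul_assoc] using hV)
      refine Nat.le_floor ((le_div_iff₀ (by norm_num)).2 ?_)
      rw [← NNReal.coe_le_coe] at hVC ⊢
      push_cast at hVC ⊢
      linarith
    have hB : (B : ℝ≥0) * 3 ≤ 2 + 4 * C :=
      (le_div_iff₀ (by norm_num)).1 (Nat.floor_le zero_le)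
    have hBC : (B : ℝ≥0) + 1 ≤ C * 4 := by
      norm_cast at hC
      rw [← NNReal.coe_le_coe] at hB hC ⊢
      push_cast at hB hC ⊢
      obtain hB1 | hB2 := Nat.lt_or_ge B 2
      · have : (B : ℝ) ≤ 1 := by exact_mod_cast Nat.lt_succ_iff.1 hB1
        linarith
      · have : (2 : ℝ) ≤ B := by exact_mod_cast hB2
        linarith
    exact (add_le_add_left hn 1).trans (by exact_mod_cast hBC)

theorem sq_lintegral_le_lintegral_mul_lintegral {α : Type*} [MeasurableSpace α] {μ : Measure α}
    {g a b : α → ℝ≥0∞} (ha : AEMeasurable a μ) (hb : AEMeasurable b μ)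
    (h : ∀ x, g x ^ 2 ≤ a x * b x) :
    (∫⁻ x, g x ∂μ) ^ 2 ≤ (∫⁻ x, a x ∂μ) * ∫⁻ x, b x ∂μ := by
  have hroot : ∀ x, g x ≤ a x ^ (1 / 2 : ℝ) * b x ^ (1 / 2 : ℝ) := fun x => by
    rw [← ENNReal.mul_rpow_of_nonneg _ _ (by norm_num), ← ENNReal.rpow_inv_le_iff (by norm_num)]
    simpa using h x
  have hCS := (lintegral_mono hroot).trans
    (ENNReal.lintegral_mul_norm_pow_le ha hb (by norm_num) (by norm_num) (by norm_num))
  rw [← ENNReal.mul_rpow_of_nonneg _ _ (by norm_num), ← ENNReal.rpow_inv_le_iff (by norm_num)]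
    at hCS
  simpa using hCS

theorem sq_tsum_le_tsum_mul_tsum {ι : Type*} {g a b : ι → ℝ≥0∞} (h : ∀ i, g i ^ 2 ≤ a i * b i) :
    (∑' i, g i) ^ 2 ≤ (∑' i, a i) * ∑' i, b i := by
  let _ : MeasurableSpace ι := ⊤
  simp only [← lintegral_count]
  exact sq_lintegral_le_lintegral_mul_lintegral (measurable_from_top).aemeasurable
    (measurable_from_top).aemeasurable h

theorem lintegral_gaussianReal_add {k : ℝ → ℝ≥0∞} (hk : Measurable k) (δ : ℝ) :
    ∫⁻ x, k (x + δ) ∂gaussianReal 0 1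
      = ∫⁻ x, ENNReal.ofReal (Real.exp (δ * x - δ ^ 2 / 2)) * k x ∂gaussianReal 0 1 := by
  rw [← lintegral_map (f := k) hk (by fun_prop), gaussianReal_map_add_const,
    gaussianReal_of_var_ne_zero _ one_ne_zero, gaussianReal_of_var_ne_zero _ one_ne_zero,
    lintegral_withDensity_eq_lintegral_mul _ (measurable_gaussianPDF _ _) hk,
    lintegral_withDensity_eq_lintegral_mul _ (measurable_gaussianPDF _ _) (by fun_prop)]
  refine lintegral_congr fun x => ?_
  simp only [Pi.mul_apply, gaussianPDF, gaussianPDFReal]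
  rw [← mul_assoc, ← ENNReal.ofReal_mul (by positivity), mul_assoc _ (Real.exp _), ← Real.exp_add]
  congr 4
  simp
  ring

theorem exp_mul_sq_lintegral_gaussianReal_le {g a b : ℝ → ℝ≥0∞} (ha : Measurable a)
    (hb : Measurable b) {t δ : ℝ}
    (h : ∀ x, ENNReal.ofReal (Real.exp (t + δ ^ 2)) * g x ^ 2 ≤ a x * b x) :
    ENNReal.ofReal (Real.exp t) * (∫⁻ x, g x ∂gaussianReal 0 1) ^ 2
      ≤ (∫⁻ x, a (x - δ) ∂gaussianReal 0 1) * ∫⁻ x, b (x + δ) ∂gaussianReal 0 1 := by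
  have hroot : ENNReal.ofReal (Real.exp t) = ENNReal.ofReal (Real.exp (t / 2)) ^ 2 := by
    rw [← ENNReal.ofReal_pow (Real.exp_nonneg _), ← Real.exp_nat_mul]
    congr 2
    push_cast
    ring
  simp only [sub_eq_add_neg]
  rw [lintegral_gaussianReal_add ha, lintegral_gaussianReal_add hb, hroot, ← mul_pow,
    ← lintegral_const_mul' _ _ ENNReal.ofReal_ne_top]
  refine sq_lintegral_le_lintegral_mul_lintegral (by fun_prop) (by fun_prop) fun x => ?_
  have hexp : Real.exp t = Real.exp (-δ * x - (-δ) ^ 2 / 2) * Real.exp (δ * x - δ ^ 2 / 2)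
      * Real.exp (t + δ ^ 2) := by
    rw [← Real.exp_add, ← Real.exp_add]
    congr 1
    ring
  rw [mul_pow, ← hroot, hexp, ENNReal.ofReal_mul (by positivity),
    ENNReal.ofReal_mul (by positivity), mul_mul_mul_comm, mul_assoc]
  exact mul_le_mul_right (h x) _

theorem iIndepFun_eval_stdNoise : iIndepFun (fun (i : ℕ) (ω : ℕ → ℝ) => ω i) stdNoise :=
  iIndepFun_infinitePi (P := fun _ : ℕ => gaussianReal 0 1) (X := fun _ x => x)
    fun _ => measurable_id

theorem measurePreserving_eval_stdNoise (i : ℕ) :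
    MeasurePreserving (fun ω => ω i) stdNoise (gaussianReal 0 1) :=
  measurePreserving_eval_infinitePi (fun _ : ℕ => gaussianReal 0 1) i

namespace AdaptiveInfo

variable {F : Type*} [NormedAddCommGroup F] [NormedSpace ℝ F] {N : AdaptiveInfo F}

variable (N) in
/-- The observations obtained from `y` by one more noisy evaluation of `f`, with normalized
noise `x`. -/
noncomputable def extend (f : F) {n : ℕ} (y : Fin n → ℝ) (x : ℝ) : Fin (n + 1) → ℝ :=
  Fin.snoc (α := fun _ => ℝ) y (N.L n y f + N.σ n y * x)

theorem obs_succ (f : F) (ω : ℕ → ℝ) (n : ℕ) :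
    N.obs f ω (n + 1) = N.extend f (N.obs f ω n) (ω n) := rfl

theorem obs_congr (f : F) {ω ω' : ℕ → ℝ} {n : ℕ} (h : ∀ i < n, ω i = ω' i) :
    N.obs f ω n = N.obs f ω' n := by
  induction n with
  | zero => rfl
  | succ n ih => rw [obs_succ, obs_succ, ih fun i hi => h i (hi.trans n.lt_succ_self),
      h n n.lt_succ_self]

namespace IsMeasurable

theorem measurable_extend (hN : N.IsMeasurable) (f : F) (n : ℕ) :
    Measurable fun p : (Fin n → ℝ) × ℝ => N.extend f p.1 p.2 := by
  refine measurable_pi_iff.2 fun i => Fin.lastCases ?_ (fun j => ?_) i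
  · simp only [extend, Fin.snoc_last]
    exact ((hN.measurable_L n f).comp measurable_fst).add
      (((hN.measurable_σ n).comp measurable_fst).coe_nnreal_real.mul measurable_snd)
  · simp only [extend, Fin.snoc_castSucc]
    exact (measurable_pi_apply j).comp measurable_fst

theorem indepFun_obs (hN : N.IsMeasurable) (f : F) (n : ℕ) :
    IndepFun (fun ω => N.obs f ω n) (fun ω => ω n) stdNoise := by
  have hsplit := iIndepFun_eval_stdNoise.indepFun_finset (Finset.range n) {n} (by simp)
    fun i => measurable_pi_apply i
  have hext : Measurable fun (z : Finset.range n → ℝ) (i : ℕ) =>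
      if hi : i ∈ Finset.range n then z ⟨i, hi⟩ else 0 := by
    refine measurable_pi_iff.2 fun i => ?_
    split_ifs
    · exact measurable_pi_apply _
    · exact measurable_const
  have hcomp := hsplit.comp (hN.measurable_obs (hN.measurableEval_const f) hext n)
    (measurable_pi_apply ⟨n, Finset.mem_singleton_self n⟩)
  refine hcomp.congr (.of_forall fun ω => ?_) (.of_forall fun ω => rfl)
  exact obs_congr f fun i hi => by simp [hi]

theorem lintegral_obs_succ (hN : N.IsMeasurable) (f : F) {n : ℕ} {g : (Fin (n + 1) → ℝ) → ℝ≥0∞}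
    (hg : Measurable g) :
    ∫⁻ ω, g (N.obs f ω (n + 1)) ∂stdNoise
      = ∫⁻ ω, ∫⁻ x, g (N.extend f (N.obs f ω n) x) ∂gaussianReal 0 1 ∂stdNoise := by
  have hobs : Measurable fun ω => N.obs f ω n :=
    hN.measurable_obs (hN.measurableEval_const f) measurable_id n
  have hlast : Measurable fun ω : ℕ → ℝ => ω n := measurable_pi_apply n
  have hpair := (indepFun_iff_map_prod_eq_prod_map_map hobs.aemeasurable hlast.aemeasurable).1
    (hN.indepFun_obs f n)
  have hH : Measurable fun p : (Fin n → ℝ) × ℝ => g (N.extend f p.1 p.2) :=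
    hg.comp (hN.measurable_extend f n)
  calc ∫⁻ ω, g (N.obs f ω (n + 1)) ∂stdNoise
      = ∫⁻ p, g (N.extend f p.1 p.2) ∂(stdNoise.map fun ω => N.obs f ω n).prod
          (gaussianReal 0 1) := by
        rw [← (measurePreserving_eval_stdNoise n).map_eq, ← hpair]
        exact (lintegral_map hH (hobs.prodMk hlast)).symm
    _ = _ := by
        rw [lintegral_prod _ hH.aemeasurable]
        exact lintegral_map hH.lintegral_prod_right' hobs

end IsMeasurable

end AdaptiveInfo

namespace AdaptiveInfo

/-- The sum of the values of `φ` at the proper initial segments of a sequence of observations: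
the total of a quantity, such as the cost, that each observation contributes to depending on the
previous ones. -/
def prefixSum {M : Type*} [AddCommMonoid M] (φ : (i : ℕ) → (Fin i → ℝ) → M) (n : ℕ)
    (y : Fin n → ℝ) : M :=
  ∑ i : Fin n, φ i (Fin.take i i.is_lt.le y)

theorem measurable_prefixSum {M : Type*} [AddCommMonoid M] [MeasurableSpace M] [MeasurableAdd₂ M]
    {φ : (i : ℕ) → (Fin i → ℝ) → M} (hφ : ∀ i, Measurable (φ i)) (n : ℕ) :
    Measurable (prefixSum φ n) :=
  Finset.measurable_sum _ fun i _ =>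
    (hφ i).comp (measurable_pi_iff.2 fun _ => measurable_pi_apply _)

variable {F : Type*} [NormedAddCommGroup F] [NormedSpace ℝ F] {N : AdaptiveInfo F}

theorem prefixSum_extend {M : Type*} [AddCommMonoid M] (φ : (i : ℕ) → (Fin i → ℝ) → M) (f : F)
    {n : ℕ} (y : Fin n → ℝ) (x : ℝ) :
    prefixSum φ (n + 1) (N.extend f y x) = prefixSum φ n y + φ n y := by
  have htake : ∀ (m : ℕ) (h : m ≤ n), Fin.take m (h.trans n.le_succ) (N.extend f y x)
      = Fin.take m h y := fun m h => by
    funext i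
    exact Fin.snoc_castSucc (α := fun _ => ℝ) _ y (i.castLE h)
  rw [prefixSum, Fin.sum_univ_castSucc]
  congr 1
  · exact Finset.sum_congr rfl fun i _ => congrArg (φ i) (htake i i.is_lt.le)
  · exact congrArg (φ n) (htake n le_rfl)

theorem prefixSum_obs {M : Type*} [AddCommMonoid M] (φ : (i : ℕ) → (Fin i → ℝ) → M) (f : F)
    (ω : ℕ → ℝ) (n : ℕ) :
    prefixSum φ n (N.obs f ω n) = ∑ i ∈ Finset.range n, φ i (N.obs f ω i) := by
  rw [← Fin.sum_univ_eq_sum_range fun i => φ i (N.obs f ω i)]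
  exact Finset.sum_congr rfl fun i _ => by rw [N.take_obs]

variable (N)

/-- The total cost of a sequence of observations. -/
noncomputable def pathCost (cost : ℝ≥0 → ℝ≥0∞) : (n : ℕ) → (Fin n → ℝ) → ℝ≥0∞ :=
  prefixSum fun i y => cost (N.σ i y)

/-- The Fisher information `σ⁻²` of the observation made after `y`, infinite if it is exact. -/
noncomputable def fisher (i : ℕ) (y : Fin i → ℝ) : ℝ≥0∞ := ((N.σ i y : ℝ≥0∞) ^ 2)⁻¹

/-- The translation of the normalized noise that has the same effect on the observation made
after `y` as adding `u` to the instance; meaningful only if that observation is not exact. -/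
noncomputable def noiseShift (u : F) (i : ℕ) (y : Fin i → ℝ) : ℝ := N.L i y u / N.σ i y

variable {N}

theorem IsMeasurable.measurable_pathCost (hN : N.IsMeasurable) {cost : ℝ≥0 → ℝ≥0∞}
    (hcost : Measurable cost) (n : ℕ) : Measurable (N.pathCost cost n) :=
  measurable_prefixSum (fun i => hcost.comp (hN.measurable_σ i)) n

theorem extend_add {n : ℕ} {y : Fin n → ℝ} (hσ : N.σ n y ≠ 0) (f u : F) (x : ℝ) :
    N.extend (f + u) y x = N.extend f y (x + N.noiseShift u n y) := by
  have hσ' : (N.σ n y : ℝ) ≠ 0 := by exact_mod_cast hσ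
  rw [extend, extend, noiseShift, mul_add, mul_div_cancel₀ _ hσ', map_add]
  congr 1
  ring

theorem extend_sub {n : ℕ} {y : Fin n → ℝ} (hσ : N.σ n y ≠ 0) (f u : F) (x : ℝ) :
    N.extend (f - u) y x = N.extend f y (x - N.noiseShift u n y) := by
  simpa only [sub_add_cancel] using (extend_add hσ (f - u) u (x - N.noiseShift u n y)).symm

theorem ofReal_prefixSum_noiseShift_sq_le (u : F) (n : ℕ) (y : Fin n → ℝ) :
    ENNReal.ofReal (prefixSum (fun i y => N.noiseShift u i y ^ 2) n y)
      ≤ ‖u‖ₑ ^ 2 * prefixSum N.fisher n y := by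
  rw [prefixSum, prefixSum, Finset.mul_sum, ENNReal.ofReal_sum_of_nonneg fun _ _ => sq_nonneg _]
  refine Finset.sum_le_sum fun i _ => ?_
  set z := Fin.take i i.is_lt.le y
  have hL : ‖N.L i z u‖ₑ ≤ ‖u‖ₑ := by
    simpa only [one_mul, enorm_le_iff_norm_le] using (N.L i z).le_of_opNorm_le (N.norm_L_le i z) u
  rcases eq_or_ne (N.σ i z) 0 with hσ | hσ
  · simp [noiseShift, hσ]
  · calc ENNReal.ofReal (N.noiseShift u i z ^ 2) = ‖N.L i z u‖ₑ ^ 2 * N.fisher i z := by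
          rw [← sq_abs, ENNReal.ofReal_pow (abs_nonneg _), ← Real.enorm_eq_ofReal_abs, noiseShift,
            fisher, div_eq_mul_inv, enorm_mul, mul_pow, ENNReal.inv_pow, enorm_inv (by simpa)]
          simp
      _ ≤ _ := by gcongr

theorem IsMeasurable.sq_lintegral_obs_le (hN : N.IsMeasurable) (f u : F) {n : ℕ}
    {g a b : (Fin n → ℝ) → ℝ≥0∞} (hg : Measurable g) (ha : Measurable a) (hb : Measurable b)
    (hexact : ∀ y, prefixSum N.fisher n y = ∞ → g y = 0)
    (h : ∀ y, ENNReal.ofReal (Real.exp (prefixSum (fun i y => N.noiseShift u i y ^ 2) n y))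
      * g y ^ 2 ≤ a y * b y) :
    (∫⁻ ω, g (N.obs f ω n) ∂stdNoise) ^ 2
      ≤ (∫⁻ ω, a (N.obs (f - u) ω n) ∂stdNoise) * ∫⁻ ω, b (N.obs (f + u) ω n) ∂stdNoise := by
  induction n with
  | zero => simpa [AdaptiveInfo.obs, prefixSum] using h Fin.elim0
  | succ n ih =>
    have hext : ∀ (f' : F) {k : (Fin (n + 1) → ℝ) → ℝ≥0∞}, Measurable k →
        Measurable fun p : (Fin n → ℝ) × ℝ => k (N.extend f' p.1 p.2) := fun f' _ hk =>
      hk.comp (hN.measurable_extend f' n)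
    rw [hN.lintegral_obs_succ f hg, hN.lintegral_obs_succ (f - u) ha,
      hN.lintegral_obs_succ (f + u) hb]
    refine ih (hext f hg).lintegral_prod_right' (hext (f - u) ha).lintegral_prod_right'
      (hext (f + u) hb).lintegral_prod_right' (fun y hy => ?_) fun y => ?_
    · have hzero : ∀ x, g (N.extend f y x) = 0 := fun x =>
        hexact _ (by rw [prefixSum_extend, hy, top_add])
      simp [hzero]
    · rcases eq_or_ne (N.σ n y) 0 with hσ | hσ
      · have hzero : ∀ x, g (N.extend f y x) = 0 := fun x =>
          hexact _ (by simp [prefixSum_extend, fisher, hσ])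
        simp [hzero]
      · simp only [extend_add hσ, extend_sub hσ]
        refine exp_mul_sq_lintegral_gaussianReal_le (g := fun x => g (N.extend f y x))
          (a := fun x => a (N.extend f y x)) (b := fun x => b (N.extend f y x))
          ((hext f ha).comp measurable_prodMk_left) ((hext f hb).comp measurable_prodMk_left)
          fun x => ?_
        simpa only [prefixSum_extend] using h (N.extend f y x)

theorem IsMeasurable.lintegral_comp_numObs_eq_tsum (hN : N.IsMeasurable) (f : F)
    {g : (n : ℕ) → (Fin n → ℝ) → ℝ≥0∞} (hg : ∀ n, Measurable (g n)) :
    ∫⁻ ω, g (N.numObs f ω) (N.obs f ω (N.numObs f ω)) ∂stdNoise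
      = ∑' n, ∫⁻ ω, (N.Y n).indicator (g n) (N.obs f ω n) ∂stdNoise := by
  have hmeas : ∀ n, Measurable fun ω => (N.Y n).indicator (g n) (N.obs f ω n) := fun n =>
    ((hg n).indicator (hN.measurableSet_Y n)).comp
      (hN.measurable_obs (hN.measurableEval_const f) measurable_id n)
  rw [← lintegral_tsum fun n => (hmeas n).aemeasurable]
  refine lintegral_congr fun ω => ?_
  rw [tsum_eq_single (N.numObs f ω) fun n hn =>
      Set.indicator_of_notMem (fun hmem => hn (N.numObs_eq_iff.2 hmem).symm) _,
    Set.indicator_of_mem (N.obs_numObs_mem f ω)]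

theorem IsMeasurable.sq_lintegral_comp_numObs_le (hN : N.IsMeasurable) (f : F) {u : F}
    {h J : ℝ≥0} (hu : ‖u‖ ≤ h) {g a b : (n : ℕ) → (Fin n → ℝ) → ℝ≥0∞}
    (hg : ∀ n, Measurable (g n)) (ha : ∀ n, Measurable (a n)) (hb : ∀ n, Measurable (b n))
    (hJ : ∀ n y, g n y ≠ 0 → prefixSum N.fisher n y ≤ J)
    (hab : ∀ n y, ENNReal.ofReal (Real.exp (h ^ 2 * J)) * g n y ^ 2 ≤ a n y * b n y) :
    (∫⁻ ω, g (N.numObs f ω) (N.obs f ω (N.numObs f ω)) ∂stdNoise) ^ 2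
      ≤ (∫⁻ ω, a (N.numObs (f - u) ω) (N.obs (f - u) ω (N.numObs (f - u) ω)) ∂stdNoise)
        * ∫⁻ ω, b (N.numObs (f + u) ω) (N.obs (f + u) ω (N.numObs (f + u) ω)) ∂stdNoise := by
  rw [hN.lintegral_comp_numObs_eq_tsum f hg, hN.lintegral_comp_numObs_eq_tsum _ ha,
    hN.lintegral_comp_numObs_eq_tsum _ hb]
  refine sq_tsum_le_tsum_mul_tsum fun n => ?_
  have hY := hN.measurableSet_Y n
  refine hN.sq_lintegral_obs_le f u ((hg n).indicator hY) ((ha n).indicator hY)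
    ((hb n).indicator hY) (fun y hy => ?_) fun y => ?_
  · refine Set.indicator_apply_eq_zero.2 fun _ => ?_
    by_contra hne
    exact ((hJ n y hne).trans_lt ENNReal.coe_lt_top).ne hy
  · by_cases hmem : y ∈ N.Y n
    swap
    · simp [hmem]
    simp only [Set.indicator_of_mem hmem]
    rcases eq_or_ne (g n y) 0 with hzero | hne
    · simp [hzero]
    refine le_trans ?_ (hab n y)
    have hshift : ENNReal.ofReal (prefixSum (fun i y => N.noiseShift u i y ^ 2) n y)
        ≤ ENNReal.ofReal (h ^ 2 * J) := by
      refine (ofReal_prefixSum_noiseShift_sq_le u n y).trans ?_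
      rw [ENNReal.ofReal_mul (by positivity), ENNReal.ofReal_pow h.coe_nonneg,
        ENNReal.ofReal_coe_nnreal, ENNReal.ofReal_coe_nnreal]
      gcongr
      · exact enorm_le_coe.2 hu
      · exact hJ n y hne
    gcongr
    exact (ENNReal.ofReal_le_ofReal_iff (by positivity)).1 hshift

end AdaptiveInfo

section CheapPath

variable {F G : Type*} [NormedAddCommGroup F] [NormedSpace ℝ F]
  [NormedAddCommGroup G] [NormedSpace ℝ G]

theorem exists_norm_le_and_mul_enorm_le_enorm {S : F →L[ℝ] G} (hS : S ≠ 0) {δ h : ℝ≥0}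
    (hδh : 2 * δ ≤ h) : ∃ v : F, ‖v‖ ≤ h ∧ δ * ‖S‖ₑ ≤ ‖S v‖ₑ := by
  obtain ⟨x, hx, hSx⟩ := S.exists_lt_apply_of_lt_opNorm (half_lt_self (norm_pos_iff.2 hS))
  refine ⟨(h : ℝ) • x, ?_, ?_⟩
  · rw [norm_smul, Real.norm_of_nonneg h.coe_nonneg]
    exact mul_le_of_le_one_right h.coe_nonneg hx.le
  · have hle : δ * ‖S‖ ≤ ‖S ((h : ℝ) • x)‖ := by
      rw [map_smul, norm_smul, Real.norm_of_nonneg h.coe_nonneg]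
      calc δ * ‖S‖ = 2 * δ * (‖S‖ / 2) := by ring
        _ ≤ h * ‖S x‖ := by gcongr; exact_mod_cast hδh
    rw [enorm_eq_nnnorm, enorm_eq_nnnorm]
    exact_mod_cast hle

theorem exp_one_mul_sq_le_mul_of_mul_le_enorm {C c ρ : ℝ≥0∞} {w z : G} (hw : 8 * ρ ≤ ‖w‖ₑ) :
    ENNReal.ofReal (Real.exp 1) * (3 * ρ ^ 2 * (2 * C - c)) ^ 2
      ≤ C * (ρ ^ 2 + ‖-w - z‖ₑ ^ 2) * (C * (ρ ^ 2 + ‖w - z‖ₑ ^ 2)) := by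
  have hsum : 128 * ρ ^ 2 ≤ ‖-w - z‖ₑ ^ 2 + ‖w - z‖ₑ ^ 2 := by
    calc 128 * ρ ^ 2 = 2 * (8 * ρ) ^ 2 := by ring
      _ ≤ 2 * ‖w‖ₑ ^ 2 := by gcongr
      _ ≤ ‖-z - w‖ₑ ^ 2 + ‖-z + w‖ₑ ^ 2 := (two_mul_enorm_sq_le (-z) w).trans_eq (add_comm _ _)
      _ = _ := by rw [neg_sub_comm, neg_add_eq_sub]
  calc ENNReal.ofReal (Real.exp 1) * (3 * ρ ^ 2 * (2 * C - c)) ^ 2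
      ≤ 3 * (3 * ρ ^ 2 * (2 * C)) ^ 2 := by
        gcongr
        · exact (ENNReal.ofReal_le_ofReal Real.exp_one_lt_three.le).trans_eq (by simp)
        · exact tsub_le_self
    _ = C * (C * (ρ ^ 2 * (108 * ρ ^ 2))) := by ring
    _ ≤ C * (C * (ρ ^ 2 * (‖-w - z‖ₑ ^ 2 + ‖w - z‖ₑ ^ 2))) := by
        gcongr
        refine le_trans ?_ hsum
        gcongr
        norm_num
    _ ≤ C * (C * (ρ ^ 2 * (‖-w - z‖ₑ ^ 2 + ‖w - z‖ₑ ^ 2)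
          + (ρ ^ 2 * ρ ^ 2 + ‖-w - z‖ₑ ^ 2 * ‖w - z‖ₑ ^ 2))) := by gcongr; exact le_self_add
    _ = _ := by ring

theorem le_lintegral_two_mul_sub {α : Type*} [MeasurableSpace α] {μ : Measure α}
    [IsProbabilityMeasure μ] {c : α → ℝ≥0∞} (hc : Measurable c) {C : ℝ≥0∞} (hC : C ≠ ∞)
    (hle : ∫⁻ x, c x ∂μ ≤ C) : C ≤ ∫⁻ x, (2 * C - c x) ∂μ :=
  calc C = 2 * C - C := by rw [two_mul, ENNReal.add_sub_cancel_right hC]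
    _ ≤ ∫⁻ _, 2 * C ∂μ - ∫⁻ x, c x ∂μ := by simpa using tsub_le_tsub_left hle _
    _ ≤ _ := lintegral_sub_le _ _ hc

theorem lintegral_mul_add_enorm_sq_le {S : F →L[ℝ] G} {K : Set F} {N : AdaptiveInfo F}
    {Φ : Algorithm G} {C r : ℝ≥0∞} (hC : C ≠ ∞) (herr : errWA S K N Φ ≤ r) {f : F} (hf : f ∈ K) :
    ∫⁻ ω, C * (r ^ 2 + ‖S f - output N Φ f ω‖ₑ ^ 2) ∂stdNoise ≤ 2 * r ^ 2 * C := by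
  rw [lintegral_const_mul' _ _ hC, lintegral_add_left measurable_const, mul_comm, two_mul]
  gcongr
  · simp
  · exact lintegral_sq_le_of_errWA_le herr hf

theorem AdaptiveInfo.IsMeasurable.costWA_le_lintegral_sub_pathCost {N : AdaptiveInfo F}
    (hN : N.IsMeasurable) {cost : ℝ≥0 → ℝ≥0∞} (hcost : Measurable cost) {K : Set F}
    (hC : costWA cost K N ≠ ∞) {f : F} (hf : f ∈ K) :
    costWA cost K N ≤ ∫⁻ ω, (2 * costWA cost K N
      - N.pathCost cost (N.numObs f ω) (N.obs f ω (N.numObs f ω))) ∂stdNoise := by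
  refine le_lintegral_two_mul_sub ?_ hC ?_
  · exact hN.measurable_comp_numObs (hN.measurableEval_const f) measurable_id
      (u := fun n ω => N.pathCost cost n (N.obs f ω n)) fun n =>
        (hN.measurable_pathCost hcost n).comp
          (hN.measurable_obs (hN.measurableEval_const f) measurable_id n)
  · simp only [AdaptiveInfo.pathCost, AdaptiveInfo.prefixSum_obs]
    exact lintegral_le_costWA cost N hf

theorem sq_three_mul_le_sq_two_mul_of_prefixSum_fisher_le {S : F →L[ℝ] G} {N : AdaptiveInfo F}
    {Φ : Algorithm G} (hN : N.IsMeasurable) (hΦ : ∀ n, StronglyMeasurable (Φ n))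
    {cost : ℝ≥0 → ℝ≥0∞} (hcost : Measurable cost) {ρ : ℝ≥0∞} (hρ : ρ ≠ ∞)
    (herr : errWA S (Metric.closedBall 0 1) N Φ ≤ ρ)
    (hC : costWA cost (Metric.closedBall 0 1) N ≠ ∞) {h : ℝ≥0} (hh : 0 < h)
    (h1 : h ≤ 1) {v : F} (hv : ‖v‖ ≤ h) (hSv : 8 * ρ ≤ ‖S v‖ₑ)
    (hcheap : ∀ n y, N.pathCost cost n y ≤ 2 * costWA cost (Metric.closedBall 0 1) N →
      AdaptiveInfo.prefixSum N.fisher n y ≤ ((h : ℝ≥0∞) ^ 2)⁻¹) :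
    (3 * ρ ^ 2 * costWA cost (Metric.closedBall 0 1) N) ^ 2
      ≤ (2 * ρ ^ 2 * costWA cost (Metric.closedBall 0 1) N) ^ 2 := by
  set C := costWA cost (Metric.closedBall 0 1) N
  have hball : ∀ w : F, ‖w‖ ≤ h → w ∈ Metric.closedBall (0 : F) 1 := fun w hw => by
    simpa using hw.trans (by exact_mod_cast h1)
  have hcmp := hN.sq_lintegral_comp_numObs_le 0 hv (J := (h ^ 2)⁻¹)
    (g := fun n y => 3 * ρ ^ 2 * (2 * C - N.pathCost cost n y))
    (a := fun n y => C * (ρ ^ 2 + ‖-S v - Φ n y‖ₑ ^ 2))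
    (b := fun n y => C * (ρ ^ 2 + ‖S v - Φ n y‖ₑ ^ 2))
    (fun n => (measurable_const.sub (hN.measurable_pathCost hcost n)).const_mul _)
    (fun n => (((stronglyMeasurable_const.sub (hΦ n)).enorm.pow_const 2).const_add _).const_mul _)
    (fun n => (((stronglyMeasurable_const.sub (hΦ n)).enorm.pow_const 2).const_add _).const_mul _)
    (fun n y hne => ?_) (fun n y => ?_)
  · rw [zero_sub, zero_add] at hcmp
    have hg := hN.costWA_le_lintegral_sub_pathCost hcost hC (hball 0 (by simp))
    have ha := lintegral_mul_add_enorm_sq_le hC herr (hball (-v) (by simpa))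
    have hb := lintegral_mul_add_enorm_sq_le hC herr (hball v hv)
    rw [sq (2 * ρ ^ 2 * C)]
    refine le_trans ?_ (hcmp.trans (mul_le_mul' ?_ hb))
    · rw [lintegral_const_mul' _ _ (by finiteness)]
      gcongr
    · simpa only [output, map_neg] using ha
  · rw [ENNReal.coe_inv (by positivity), ENNReal.coe_pow]
    exact hcheap n y (tsub_pos_iff_lt.1 (pos_iff_ne_zero.2 (right_ne_zero_of_mul hne))).le
  · have hexp : (h : ℝ) ^ 2 * ((h ^ 2)⁻¹ : ℝ≥0) = 1 := by
      push_cast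
      exact mul_inv_cancel₀ (by positivity)
    rw [hexp]
    exact exp_one_mul_sq_le_mul_of_mul_le_enorm hSv

theorem exists_pathCost_le_and_lt_prefixSum_fisher {S : F →L[ℝ] G} (hS : S ≠ 0)
    {N : AdaptiveInfo F} {Φ : Algorithm G} (hN : N.IsMeasurable)
    (hΦ : ∀ n, StronglyMeasurable (Φ n)) {cost : ℝ≥0 → ℝ≥0∞} (hcost : Measurable cost)
    {ε h : ℝ≥0} (hε : 0 < ε) (hεh : 16 * ε ≤ h) (h1 : h ≤ 1)
    (herr : errWA S (Metric.closedBall 0 1) N Φ ≤ ε * ‖S‖ₑ)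
    (hC0 : costWA cost (Metric.closedBall 0 1) N ≠ 0)
    (hC : costWA cost (Metric.closedBall 0 1) N ≠ ∞) :
    ∃ n y, N.pathCost cost n y ≤ 2 * costWA cost (Metric.closedBall 0 1) N ∧
      ((h : ℝ≥0∞) ^ 2)⁻¹ < AdaptiveInfo.prefixSum N.fisher n y := by
  set C := costWA cost (Metric.closedBall 0 1) N
  set ρ : ℝ≥0∞ := ε * ‖S‖ₑ
  obtain ⟨v, hv, hSv⟩ := exists_norm_le_and_mul_enorm_le_enorm hS (δ := 8 * ε) (h := h)
    (by rwa [← mul_assoc, show (2 * 8 : ℝ≥0) = 16 by norm_num])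
  have hρv : 8 * ρ ≤ ‖S v‖ₑ := by simpa [ρ, mul_assoc] using hSv
  by_contra! hcheap
  have hsq := sq_three_mul_le_sq_two_mul_of_prefixSum_fisher_le hN hΦ hcost (ρ := ρ)
    (by finiteness) herr hC ((mul_pos (by norm_num) hε).trans_le hεh) h1 hv hρv hcheap
  have hle : 3 * (ρ ^ 2 * C) ≤ 2 * (ρ ^ 2 * C) := by
    simpa only [mul_assoc] using (ENNReal.pow_le_pow_left_iff two_ne_zero).1 hsq
  have hlt : (2 : ℝ≥0∞) < 3 := by norm_num
  have hne : ρ ^ 2 * C ≠ 0 := by simp [ρ, hε.ne', enorm_eq_nnnorm, hS, hC0]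
  exact hle.not_gt ((ENNReal.mul_lt_mul_iff_left hne (by finiteness)).2 hlt)

end CheapPath

theorem lintegral_enorm_sum_mul_sq_stdNoise {n : ℕ} (a : Fin n → ℝ) :
    ∫⁻ ω, ‖∑ i : Fin n, a i * ω i‖ₑ ^ 2 ∂stdNoise = ENNReal.ofReal (∑ i, a i ^ 2) := by
  have hlaw : ∀ i : ℕ, HasLaw (fun ω : ℕ → ℝ => ω i) (gaussianReal 0 1) stdNoise := fun i =>
    (measurePreserving_eval_stdNoise i).hasLaw
  have hLp : ∀ i : Fin n, MemLp (fun ω : ℕ → ℝ => a i * ω i) 2 stdNoise := fun i =>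
    ((memLp_id_gaussianReal 2).comp_measurePreserving
      (measurePreserving_eval_stdNoise i)).const_mul (a i)
  have hmean : ∫ ω, ∑ i : Fin n, a i * ω i ∂stdNoise = 0 := by
    rw [integral_finsetSum _ fun i _ => (hLp i).integrable one_le_two]
    simp [integral_const_mul, (hlaw _).integral_eq]
  have hvar : Var[fun ω : ℕ → ℝ => ∑ i : Fin n, a i * ω i; stdNoise] = ∑ i, a i ^ 2 := by
    rw [← Finset.sum_fn, IndepFun.variance_sum (fun i _ => hLp i) fun i _ j _ hij =>
      (iIndepFun_eval_stdNoise.indepFun (Fin.val_ne_of_ne hij)).comp (measurable_const_mul (a i))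
        (measurable_const_mul (a j))]
    exact Finset.sum_congr rfl fun i _ => by
      rw [variance_const_mul, (hlaw i).variance_eq, variance_id_gaussianReal, NNReal.coe_one,
        mul_one]
  rw [← hvar, (memLp_finsetSum _ fun i _ => hLp i).ofReal_variance_eq, evariance, hmean]
  simp

section RealParameter

variable (cost : ℝ≥0 → ℕ+ → ℝ≥0∞) {s : ℝ≥0} (d : ℕ+) {n : ℕ} {τ : Fin n → ℝ≥0}

theorem auxCost_le_sum_of_weights {a : Fin n → ℝ} (ha : ∑ i, a i = 1)
    (hs : ∑ i, (a i * τ i) ^ 2 ≤ (s : ℝ) ^ 2) : auxCost cost s d ≤ ∑ i, cost (τ i) d := by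
  set Φ : Algorithm ℝ := fun m y => ∑ i : Fin m, if h : i < n then a ⟨i, h⟩ * y i else 0
  set N := AdaptiveInfo.nonadaptive (fun _ => ContinuousLinearMap.id ℝ ℝ)
    (fun _ => ContinuousLinearMap.norm_id_le) τ
  have hout : ∀ f ω, f - output N Φ f ω = -∑ i : Fin n, a i * τ i * ω i := fun f ω => by
    simp [N, Φ, AdaptiveInfo.output_nonadaptive, mul_add, Finset.sum_add_distrib,
      ← Finset.sum_mul, ha, mul_assoc]
  refine sInf_le_of_le ⟨N, Φ, fun _ _ => rfl, AdaptiveInfo.nonadaptive_isMeasurable _ _ _,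
    fun m => ?_, iSup₂_le fun f _ => ?_, rfl⟩ (iSup₂_le fun f _ => ?_)
  · refine (continuous_finsetSum _ fun i _ => ?_).stronglyMeasurable
    split_ifs <;> fun_prop
  · simp only [ContinuousLinearMap.id_apply, hout, enorm_neg]
    rw [lintegral_enorm_sum_mul_sq_stdNoise, one_div, ENNReal.rpow_inv_le_iff two_pos]
    simpa [ENNReal.ofReal_pow] using ENNReal.ofReal_le_ofReal hs
  · simp only [N, AdaptiveInfo.numObs_nonadaptive, Finset.sum_range]
    simp [AdaptiveInfo.nonadaptive]

theorem auxCost_le_sum_of_inv_sq_le (hs : ((s : ℝ≥0∞) ^ 2)⁻¹ ≤ ∑ i, ((τ i : ℝ≥0∞) ^ 2)⁻¹) :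
    auxCost cost s d ≤ ∑ i, cost (τ i) d := by
  by_cases hτ : ∃ j, τ j = 0
  · obtain ⟨j, hj⟩ := hτ
    refine auxCost_le_sum_of_weights cost d (a := Pi.single j 1) (by simp) ?_
    rw [Finset.sum_eq_zero fun i _ => ?_]
    · positivity
    · rcases eq_or_ne i j with rfl | hij
      · simp [hj]
      · simp [Pi.single_eq_of_ne hij]
  · push Not at hτ
    set I : ℝ≥0 := ∑ i, (τ i ^ 2)⁻¹ with hI
    have hcoe : ∑ i, ((τ i : ℝ≥0∞) ^ 2)⁻¹ = I := by
      rw [hI, ENNReal.ofNNReal_finsetSum]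
      exact Finset.sum_congr rfl fun i _ => by simp [ENNReal.coe_inv, hτ i]
    rw [hcoe, ENNReal.inv_le_iff_inv_le] at hs
    have hI0 : I ≠ 0 := by
      rintro h0
      simp [h0] at hs
    have hIs : I⁻¹ ≤ s ^ 2 := by
      rw [← ENNReal.coe_inv hI0] at hs
      exact_mod_cast hs
    -- inverse-variance weights
    refine auxCost_le_sum_of_weights cost d (a := fun i => ((τ i ^ 2)⁻¹ / I : ℝ≥0)) ?_ ?_
    · rw [← NNReal.coe_sum, ← Finset.sum_div, div_self hI0, NNReal.coe_one]
    · have hterm : ∀ i, ((τ i ^ 2)⁻¹ / I * τ i) ^ 2 = (τ i ^ 2)⁻¹ / I ^ 2 := fun i => by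
        have := hτ i
        field_simp
      have hsum : ∑ i, ((τ i ^ 2)⁻¹ / I * τ i) ^ 2 ≤ s ^ 2 :=
        calc ∑ i, ((τ i ^ 2)⁻¹ / I * τ i) ^ 2 = I / I ^ 2 := by
              rw [Finset.sum_congr rfl fun i _ => hterm i, ← Finset.sum_div]
          _ = I⁻¹ := by field_simp
          _ ≤ s ^ 2 := hIs
      exact_mod_cast hsum

end RealParameter

theorem auxCost_div_two_le_compWA {F G : Type*} [NormedAddCommGroup F] [NormedSpace ℝ F]
    [NormedAddCommGroup G] [NormedSpace ℝ G] {S : F →L[ℝ] G} (hS : S ≠ 0)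
    {cost : ℝ≥0 → ℕ+ → ℝ≥0∞} (hcost : IsCostFunction cost) (d : ℕ+) {ε s : ℝ≥0}
    (hε0 : 0 < ε) (hε : 16 * ε ≤ 1) (hs : 16 * ε ≤ s) :
    auxCost cost s d / 2 ≤ compWA (fun σ => cost σ d) S ε := by
  refine le_sInf ?_
  rintro _ ⟨N, Φ, hN, hΦ, herr, rfl⟩
  rcases eq_or_ne (costWA (fun σ => cost σ d) (Metric.closedBall 0 1) N) ∞ with hC | hC
  · exact le_top.trans_eq hC.symm
  have hε1 : ε < 1 := (lt_mul_of_one_lt_left hε0 (by norm_num)).trans_le hε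
  have hC1 : 1 ≤ costWA (fun σ => cost σ d) (Metric.closedBall 0 1) N :=
    one_le_costWA (hcost.one_le · d) (r := ε * ‖S‖₊)
      (mul_lt_of_lt_one_left (nnnorm_pos.2 hS) hε1) (by simpa [enorm_eq_nnnorm] using herr)
  obtain ⟨n, y, hcheap, hprecise⟩ := exists_pathCost_le_and_lt_prefixSum_fisher hS hN hΦ
    (hcost.antitone_precision d).measurable hε0 le_rfl hε herr (one_pos.trans_le hC1).ne' hC
  rw [ENNReal.div_le_iff two_ne_zero ENNReal.ofNat_ne_top, mul_comm]
  refine (auxCost_le_sum_of_inv_sq_le cost d ?_).trans hcheap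
  exact le_trans (by gcongr) hprecise.le

end NoisyInfo

theorem lemma4p1_general :
    ∃ c : ℝ≥0, 0 < c ∧ c < 1 ∧
      ∀ (F G : ℕ+ → Type*)
        [∀ d, NormedAddCommGroup (F d)] [∀ d, InnerProductSpace ℝ (F d)]
        [∀ d, CompleteSpace (F d)]
        [∀ d, NormedAddCommGroup (G d)] [∀ d, InnerProductSpace ℝ (G d)]
        (S : ∀ d, F d →L[ℝ] G d) (_ : ∀ d, S d ≠ 0)
        (cost : ℝ≥0 → ℕ+ → ℝ≥0∞) (_ : NoisyInfo.IsCostFunction cost),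
        (∀ (ε : ℝ≥0) (d : ℕ+), 0 < ε → ε < 1 →
          (NoisyInfo.nWorst (S d) (2 * ε) + 1) / 4
            ≤ NoisyInfo.compWA (fun σ => cost σ d) (S d) ε) ∧
        (∀ (ε : ℝ≥0) (d : ℕ+), 0 < ε → ε < c →
          NoisyInfo.auxCost cost (ε / (c * NNReal.sqrt 2)) d / 2
            ≤ NoisyInfo.compWA (fun σ => cost σ d) (S d) ε) := by
  refine ⟨1 / 32, by norm_num, by norm_num [← NNReal.coe_lt_coe],
    fun F G _ _ _ _ _ S hS cost hcost =>
      ⟨fun ε d h0 h1 => NoisyInfo.nWorst_add_one_div_four_le_compWA (hS d) (hcost.one_le · d) h0 h1,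
        fun ε d h0 h1 => NoisyInfo.auxCost_div_two_le_compWA (hS d) hcost d h0 ?_ ?_⟩⟩
  · calc 16 * ε ≤ 16 * (1 / 32) := by gcongr
      _ ≤ 1 := by rw [← NNReal.coe_le_coe]; norm_num
  · have hsqrt : NNReal.sqrt 2 ≤ 2 := NNReal.sqrt_le_iff_le_sq.2 (by norm_num)
    rw [le_div_iff₀ (by positivity)]
    calc 16 * ε * (1 / 32 * NNReal.sqrt 2) ≤ 16 * ε * (1 / 32 * 2) := by gcongr
      _ = ε := by ring

theorem lemma4p1 :
    ∃ c : ℝ≥0, 0 < c ∧ c < 1 ∧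
      ∀ (F G : ℕ+ → Type*)
        [∀ d, NormedAddCommGroup (F d)] [∀ d, InnerProductSpace ℝ (F d)]
        [∀ d, CompleteSpace (F d)] [∀ d, TopologicalSpace.SeparableSpace (F d)]
        [∀ d, NormedAddCommGroup (G d)] [∀ d, InnerProductSpace ℝ (G d)]
        [∀ d, CompleteSpace (G d)] [∀ d, TopologicalSpace.SeparableSpace (G d)]
        (S : ∀ d, F d →L[ℝ] G d) (_ : ∀ d, S d ≠ 0) (_ : ∀ d, IsCompactOperator (S d))
        (cost : ℝ≥0 → ℕ+ → ℝ≥0∞) (_ : NoisyInfo.IsCostFunction cost),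
        (∀ (ε : ℝ≥0) (d : ℕ+), 0 < ε → ε < 1 →
          (NoisyInfo.nWorst (S d) (2 * ε) + 1) / 4
            ≤ NoisyInfo.compWA (fun σ => cost σ d) (S d) ε) ∧
        (∀ (ε : ℝ≥0) (d : ℕ+), 0 < ε → ε < c →
          NoisyInfo.auxCost cost (ε / (c * NNReal.sqrt 2)) d / 2
            ≤ NoisyInfo.compWA (fun σ => cost σ d) (S d) ε) := by
  obtain ⟨c, hc0, hc1, h⟩ := lemma4p1_general
  exact ⟨c, hc0, hc1, fun F G _ _ _ _ _ _ _ _ S hS _ => h F G S hS⟩
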